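/- **Setting.** A finite Markov decision problem $M=(S,A,T,R,\gamma)$ has $|S|=n\ge 2$ states, $|A|=k\ge 2$ actions, transition probabilities $T(s,a,s')\in[0,1]$ with $\sum_{s'}T(s,a,s')=1$, rewards $R(s,a)\in\mathbb R$ and a discount factor $\gamma\in[0,1)$. It is *deterministic* (a DMDP) if $T$ takes values in $\{0,1\}$. For a policy $\pi:S\to A$ let $V^\pi(s)=\mathbb E\big[\sum_{t\ge0}\gamma^tR(s_t,a_t)\big]$, where $s_0=s$, $a_t=\pi(s_t)$, $s_{t+1}\sim T(s_t,a_t,\cdot)$, and let $$\rho^\pi(s,a)=R(s,a)+\gamma\sum_{s'}T(s,a,s')V^\pi(s')-V^\pi(s).$$ A policy is optimal if its value at every state is at least that of every other policy. Put $I^\pi=\{(s,a):\rho^\pi(s,a)>0\}$. A policy improvement step picks any nonempty $I\subseteq I^\pi$ containing at most one pair $(s,a)$ for each $s$, and changes $\pi(s)$ to $a$ for each $(s,a)\in I$, leaving the other actions unchanged. A run of a policy iteration (PI) algorithm with arbitrary action selection is a sequence $\pi_0,\pi_1,\dots$ that starts at any policy, in which each $\pi_{t+1}$ results from $\pi_t$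 by a policy improvement step, for as long as $I^{\pi_t}\ne\emptyset$; it terminates at the first $\pi_\ell$ with $I^{\pi_\ell}=\emptyset$. The choices of $I$ are unrestricted. Howard's PI is the case in which, at each step, every state that has an improving action is switched. Put $$\alpha(k)=\frac{k-1+\sqrt{(k-1)^2+4}}{2},\qquad \varphi=\alpha(2)=\frac{1+\sqrt5}{2}.$$ **Statement.** 1. Every run of any PI algorithm with arbitrary action selection on an $n$-state, $k$-action DMDP ($n,k\ge2$) terminates, at an optimal policy, after a finite number $\ell$ of improvement steps, and the number $\ell+1$ of policies visited satisfies $$\ell+1\le 5n^3k^2\,\alpha(k)^{n-1}.$$ 2. This bound is $O\big(n^3k\,\alpha(k)^n\big)$: there is an absolute constant $C$ with $5n^3k^2\alpha(k)^{n-1}\le C\,n^3k\,\alpha(k)^n$ for all $n,k\ge2$. 3. For $k=2$: there is an absolute constant $C$ such that every run of any PI algorithm on an $n$-state, $2$-action DMDP ($n\ge2$) terminates, at an optimal policy, with $\ell+1\le C\,n^3\varphi^n$. 4. In particular, there is an absolute constant $C$ such that every run of Howard's PI on an $n$-state, $2$-action DMDP ($n\ge2$) terminates, at an optimal policy, with $\ell+1\le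 C\,n^3F_n$, where $F_n$ is the $n$-th Fibonacci number ($F_1=F_2=1$). That is, the number of iterations of Howard's PI grows at most at the Fibonacci rate up to a polynomial factor. -/

import Mathlib

universe u v

/-- A finite Markov decision problem `(S, A, T, R, γ)`: `T s a s'` is the probability of moving to
`s'` when action `a` is taken in state `s`, `R s a` is the expected reward of taking `a` in `s`,
and `γ ∈ [0, 1)` is the discount factor. -/
structure MDP (S A : Type*) [Fintype S] where
  T : S → A → S → ℝ
  T_nonneg : ∀ s a s', 0 ≤ T s a s'
  T_sum : ∀ s a, ∑ s', T s a s' = 1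
  R : S → A → ℝ
  γ : ℝ
  γ_nonneg : 0 ≤ γ
  γ_lt_one : γ < 1

namespace MDP

variable {S A : Type*} [Fintype S]

/-- A deterministic MDP (DMDP): all transition probabilities are `0` or `1`. -/
def IsDeterministic (M : MDP S A) : Prop :=
  ∀ s a s', M.T s a s' = 0 ∨ M.T s a s' = 1

open Classical in
/-- `M.stateProb π s t s'` is the probability that `s_t = s'` for the trajectory which starts at
`s_0 = s` and follows the policy `π`: `a_t = π s_t` and `s_{t+1} ∼ T s_t a_t`. -/
noncomputable def stateProb (M : MDP S A) (π : S → A) (s : S) : ℕ → S → ℝ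
  | 0, s' => if s' = s then 1 else 0
  | t + 1, s' => ∑ u, stateProb M π s t u * M.T u (π u) s'

/-- The expected reward `𝔼[R(s_t, a_t)]` collected at time `t` when starting at `s` and
following `π`. -/
noncomputable def expectedReward (M : MDP S A) (π : S → A) (s : S) (t : ℕ) : ℝ :=
  ∑ u, M.stateProb π s t u * M.R u (π u)

/-- The value function: the expected infinite discounted reward `∑ₜ γ ^ t 𝔼[R(s_t, a_t)]`. -/
noncomputable def value (M : MDP S A) (π : S → A) (s : S) : ℝ :=
  ∑' t : ℕ, M.γ ^ t * M.expectedReward π s t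

theorem stateProb_nonneg (M : MDP S A) (π : S → A) (s : S) (t : ℕ) (u : S) :
    0 ≤ M.stateProb π s t u := by
  induction t generalizing u with
  | zero => unfold stateProb; split_ifs <;> norm_num
  | succ t ih =>
    exact Finset.sum_nonneg fun v _ => mul_nonneg (ih v) (M.T_nonneg _ _ _)

theorem stateProb_sum (M : MDP S A) (π : S → A) (s : S) (t : ℕ) :
    ∑ u, M.stateProb π s t u = 1 := by
  induction t with
  | zero =>
    simp only [stateProb]
    rw [Finset.sum_eq_single s (fun u _ h => if_neg h) (by simp), if_pos rfl]
  | succ t ih =>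
    simp only [stateProb]
    rw [Finset.sum_comm]
    simp only [← Finset.mul_sum, M.T_sum, mul_one, ih]

/-- The series which defines the value function converges (absolutely). -/
theorem summable_value (M : MDP S A) (π : S → A) (s : S) :
    Summable fun t : ℕ => M.γ ^ t * M.expectedReward π s t := by
  refine Summable.of_norm_bounded
    (g := fun t : ℕ => M.γ ^ t * ∑ u, |M.R u (π u)|)
    ((summable_geometric_of_lt_one M.γ_nonneg M.γ_lt_one).mul_right _) fun t => ?_
  rw [Real.norm_eq_abs, abs_mul, abs_of_nonneg (pow_nonneg M.γ_nonneg t)]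
  refine mul_le_mul_of_nonneg_left ?_ (pow_nonneg M.γ_nonneg t)
  refine (Finset.abs_sum_le_sum_abs _ _).trans (Finset.sum_le_sum fun u _ => ?_)
  rw [abs_mul, abs_of_nonneg (M.stateProb_nonneg π s t u)]
  refine mul_le_of_le_one_left (abs_nonneg _) ?_
  rw [← M.stateProb_sum π s t]
  exact Finset.single_le_sum (fun v _ => M.stateProb_nonneg π s t v) (Finset.mem_univ u)

/-- The action value function: take `a` in `s`, and follow `π` thereafter. -/
noncomputable def actionValue (M : MDP S A) (π : S → A) (s : S) (a : A) : ℝ :=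
  M.R s a + M.γ * ∑ s', M.T s a s' * M.value π s'

/-- The gain function `ρ`. -/
noncomputable def gain (M : MDP S A) (π : S → A) (s : S) (a : A) : ℝ :=
  M.actionValue π s a - M.value π s

/-- A policy is optimal if its value at every state is at least that of every policy. -/
def IsOptimal (M : MDP S A) (π : S → A) : Prop :=
  ∀ π' : S → A, ∀ s, M.value π' s ≤ M.value π s

/-- The set of improving state-action pairs of the policy `π`. -/
def improvableSet (M : MDP S A) (π : S → A) : Set (S × A) :=
  {p | 0 < M.gain π p.1 p.2}

/-- A valid improvement set for `π`: a nonempty set of improving state-action pairs with at most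
one action for every state. -/
def IsValidImprovementSet (M : MDP S A) (π : S → A) (I : Set (S × A)) : Prop :=
  I ⊆ M.improvableSet π ∧ I.Nonempty ∧ ∀ s a a', (s, a) ∈ I → (s, a') ∈ I → a = a'

/-- `π'` is obtained from `π` by switching to the actions given by the state-action pairs in `I`
and keeping the action of `π` at all other states. -/
def SwitchesTo (I : Set (S × A)) (π π' : S → A) : Prop :=
  (∀ s a, (s, a) ∈ I → π' s = a) ∧ ∀ s, (∀ a, (s, a) ∉ I) → π' s = π s

/-- `π'` is a locally improving policy of `π`: it results from `π` by one step of policy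
improvement, with arbitrary selection of the states to switch and of their improving actions. -/
def IsLocallyImproving (M : MDP S A) (π π' : S → A) : Prop :=
  ∃ I, M.IsValidImprovementSet π I ∧ SwitchesTo I π π'

/-- One step of Howard's policy iteration: every state with an improving action is switched. -/
def IsHowardImproving (M : MDP S A) (π π' : S → A) : Prop :=
  ∃ I, M.IsValidImprovementSet π I ∧
    (∀ s, (∃ a, (s, a) ∈ M.improvableSet π) → ∃ a, (s, a) ∈ I) ∧ SwitchesTo I π π'

/-- `π 0, π 1, …` is a run of a policy iteration algorithm with arbitrary action selection: as
long as the current policy has an improving action, the next policy results from it by policy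
improvement. The choice of the improvement set at each step is unrestricted, so it may depend on
the past, on further information, or on chance. The run stops at the first policy without improving
actions (see `TerminatesAt`), and the entries after this policy are irrelevant. -/
def IsRun (M : MDP S A) (π : ℕ → S → A) : Prop :=
  ∀ t, (M.improvableSet (π t)).Nonempty → M.IsLocallyImproving (π t) (π (t + 1))

/-- `π 0, π 1, …` is a run of Howard's policy iteration. -/
def IsHowardRun (M : MDP S A) (π : ℕ → S → A) : Prop :=
  ∀ t, (M.improvableSet (π t)).Nonempty → M.IsHowardImproving (π t) (π (t + 1))

/-- The run `π` stops after exactly `ℓ` improvement steps: `π ℓ` is its first policy without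
improving actions. The policies visited are `π 0, …, π ℓ`. -/
def TerminatesAt (M : MDP S A) (π : ℕ → S → A) (ℓ : ℕ) : Prop :=
  (∀ t < ℓ, (M.improvableSet (π t)).Nonempty) ∧ M.improvableSet (π ℓ) = ∅

end MDP

/-- The growth rate `α(k) = (k - 1 + √((k - 1)² + 4)) / 2`. -/
noncomputable def growthRate (k : ℕ) : ℝ :=
  ((k : ℝ) - 1 + Real.sqrt (((k : ℝ) - 1) ^ 2 + 4)) / 2

/-!
In a deterministic problem the value of a policy at `s₀` depends only on the lasso which the policy
traces from `s₀`, so there are at most as many values of policies at `s₀` as there are lassos. A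
lasso is a self-avoiding walk followed by one more action, so there are at most `k · ∑ₜ wₜ` lassos,
where `wₜ` is the number of self-avoiding walks from `s₀` to `t`. Since the values increase along a
run, the run is at most `n` times as long as the number of values which occur at a single state.

To bound the number of self-avoiding walks, let the edges have arbitrary weights. The total weight
of the walks is affine in the weights of the edges which leave any one vertex, so the worst case is
extremal: every vertex has a heavy edge, of weight `β = k - 1`, and a light edge, of weight `1`,
with different targets. An induction on the number of vertices then bounds the weight of the walks
by a product of vertex potentials: `α` while both edges of the vertex lead to unvisited vertices,
`(β² + 1) / α` if only the heavy one does, `2β / α` if only the light one does, and `1` if neither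
does, where `α² = β α + 1`.

The extremal case requires that fewer than `k` actions at a state share a successor. If all actions
at a state do, then a run only ever increases the reward there, so that the choices at all such
states change at most `n k` times; between two changes, each such state has a single action.
-/

section SelfAvoidingWalks

variable {V : Type*} [DecidableEq V]

/-- The total weight of the self-avoiding walks which start at `s`, continue inside `X`, and end by
taking the exit `none`. The weight of a walk is the product of the weights of its edges. -/
noncomputable def walkWeight (W : V → Option V → ℝ) (X : Finset V) (s : V) : ℝ :=
  W s none + ∑ u : X, W s (some u) * walkWeight W (X.erase u) u
termination_by X.card
decreasing_by exact Finset.card_erase_lt_of_mem u.2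

theorem walkWeight_eq (W : V → Option V → ℝ) (X : Finset V) (s : V) :
    walkWeight W X s = W s none + ∑ u ∈ X, W s (some u) * walkWeight W (X.erase u) u := by
  rw [walkWeight]
  congr 1
  exact Finset.sum_coe_sort X fun u => W s (some u) * walkWeight W (X.erase u) u

theorem walkWeight_nonneg {W : V → Option V → ℝ} (hW : ∀ v o, 0 ≤ W v o) (X : Finset V) (s : V) :
    0 ≤ walkWeight W X s := by
  induction X using Finset.strongInduction generalizing s with
  | H X ih =>
    rw [walkWeight_eq]
    exact add_nonneg (hW _ _) (Finset.sum_nonneg fun u hu =>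
      mul_nonneg (hW _ _) (ih _ (Finset.erase_ssubset hu) u))

theorem walkWeight_update_of_notMem (W : V → Option V → ℝ) {X : Finset V} {s v : V}
    (hv : v ∉ insert s X) (f : Option V → ℝ) :
    walkWeight (Function.update W v f) X s = walkWeight W X s := by
  induction X using Finset.strongInduction generalizing s with
  | H X ih =>
    obtain ⟨hsv, hvX⟩ : s ≠ v ∧ v ∉ X := by
      simpa only [Finset.mem_insert, not_or, ne_comm] using hv
    rw [walkWeight_eq, walkWeight_eq W, Function.update_of_ne hsv]
    congr 1
    refine Finset.sum_congr rfl fun u hu => ?_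
    rw [ih _ (Finset.erase_ssubset hu) (by rwa [Finset.insert_erase hu])]

theorem walkWeight_update_self (W : V → Option V → ℝ) {X : Finset V} {s : V} (hs : s ∉ X)
    (f : Option V → ℝ) :
    walkWeight (Function.update W s f) X s =
      f none + ∑ u ∈ X, f (some u) * walkWeight W (X.erase u) u := by
  rw [walkWeight_eq, Function.update_self]
  congr 1
  refine Finset.sum_congr rfl fun u hu => ?_
  rw [walkWeight_update_of_notMem _ (by rwa [Finset.insert_erase hu])]

/-- A walk through `u` enters `u` along an edge from some `v`. Deleting `u` and letting `v` take
over the outgoing edges of `u` turns it into a walk which avoids `u`. -/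
theorem walkWeight_le_erase_add_sum {W : V → Option V → ℝ} (hW : ∀ v o, 0 ≤ W v o) {X : Finset V}
    {s u : V} (hs : s ∉ X) (hu : u ∈ X) :
    walkWeight W X s ≤ walkWeight W (X.erase u) s + ∑ v ∈ (insert s X).erase u,
      W v (some u) * walkWeight (Function.update W v (W u)) (X.erase u) s := by
  induction X using Finset.strongInduction generalizing s with
  | H X ih =>
    have hsu : s ≠ u := fun e => hs (e ▸ hu)
    set shortcut : V → Finset V → V → ℝ := fun v => walkWeight (Function.update W v (W u))
    have branch_le : ∀ y ∈ X.erase u, W s (some y) * walkWeight W (X.erase y) y ≤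
        W s (some y) * walkWeight W ((X.erase u).erase y) y + ∑ v ∈ X.erase u,
          W v (some u) * (W s (some y) * shortcut v ((X.erase u).erase y) y) := by
      intro y hy
      obtain ⟨hyu, hyX⟩ := Finset.mem_erase.1 hy
      have := ih _ (Finset.erase_ssubset hyX) (Finset.notMem_erase y X)
        (Finset.mem_erase.2 ⟨hyu.symm, hu⟩)
      rw [Finset.insert_erase hyX, Finset.erase_right_comm] at this
      refine (mul_le_mul_of_nonneg_left this (hW _ _)).trans_eq ?_
      rw [mul_add, Finset.mul_sum]
      simp only [shortcut, mul_left_comm]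
    have shortcut_eq : ∀ v ∈ X.erase u, shortcut v (X.erase u) s = W s none + ∑ y ∈ X.erase u,
        W s (some y) * shortcut v ((X.erase u).erase y) y := by
      intro v hv
      have hsv : s ≠ v := fun e => hs (e ▸ Finset.mem_of_mem_erase hv)
      simp only [shortcut]
      rw [walkWeight_eq, Function.update_of_ne hsv]
    have head_eq : shortcut s (X.erase u) s = walkWeight W (X.erase u) u := by
      simp only [shortcut]
      rw [walkWeight_update_self _ (fun h => hs (Finset.mem_of_mem_erase h)), ← walkWeight_eq]
    rw [walkWeight_eq, ← Finset.add_sum_erase _ _ hu, walkWeight_eq W (X.erase u) s,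
      Finset.erase_insert_of_ne hsu, Finset.sum_insert (fun h => hs (Finset.mem_of_mem_erase h))]
    change _ ≤ _ + (_ * shortcut s (X.erase u) s + ∑ v ∈ _, _ * shortcut v (X.erase u) s)
    have tail_le : ∑ v ∈ X.erase u, ∑ y ∈ X.erase u,
        W v (some u) * (W s (some y) * shortcut v ((X.erase u).erase y) y) ≤
          ∑ v ∈ X.erase u, W v (some u) * shortcut v (X.erase u) s := by
      refine Finset.sum_le_sum fun v hv => ?_
      rw [shortcut_eq v hv, ← Finset.mul_sum]
      exact mul_le_mul_of_nonneg_left (le_add_of_nonneg_left (hW _ _)) (hW _ _)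
    have := Finset.sum_le_sum branch_le
    rw [Finset.sum_add_distrib, Finset.sum_comm] at this
    rw [head_eq]
    linarith

theorem walkWeight_le_erase {W : V → Option V → ℝ} (hW : ∀ v o, 0 ≤ W v o) {X : Finset V}
    {s u : V} (hs : s ∉ X) (hu : u ∈ X) (h : ∀ v ∈ (insert s X).erase u, W v (some u) = 0) :
    walkWeight W X s ≤ walkWeight W (X.erase u) s := by
  refine (walkWeight_le_erase_add_sum hW hs hu).trans_eq ?_
  rw [Finset.sum_eq_zero fun v hv => by rw [h v hv, zero_mul], add_zero]

theorem exists_walkWeight_update_eq [Fintype V] {W : V → Option V → ℝ} (hW : ∀ v o, 0 ≤ W v o)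
    {X : Finset V} {s : V} (hs : s ∉ X) (v : V) :
    ∃ (a : ℝ) (c : Option V → ℝ), (∀ o, 0 ≤ c o) ∧ ∀ f : Option V → ℝ,
      walkWeight (Function.update W v f) X s = a + ∑ o, f o * c o := by
  induction X using Finset.strongInduction generalizing s with
  | H X ih =>
    obtain rfl | hsv := eq_or_ne s v
    · refine ⟨0, fun o => o.elim 1 fun u => if u ∈ X then walkWeight W (X.erase u) u else 0,
        fun o => ?_, fun f => ?_⟩
      · cases o with
        | none => exact zero_le_one
        | some u =>
          simp only [Option.elim_some]
          split_ifs
          exacts [walkWeight_nonneg hW _ _, le_rfl]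
      · simp [walkWeight_update_self W hs, Fintype.sum_option]
    · choose! a c hc h using fun y (hy : y ∈ X) =>
        ih _ (Finset.erase_ssubset hy) (Finset.notMem_erase y X)
      refine ⟨W s none + ∑ y ∈ X, W s (some y) * a y, fun o => ∑ y ∈ X, W s (some y) * c y o,
        fun o => Finset.sum_nonneg fun y hy => mul_nonneg (hW _ _) (hc y hy o), fun f => ?_⟩
      have branch_eq : ∀ y ∈ X,
          W s (some y) * walkWeight (Function.update W v f) (X.erase y) y =
            W s (some y) * a y + ∑ o, f o * (W s (some y) * c y o) := by
        intro y hy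
        rw [h y hy f, mul_add, Finset.mul_sum]
        simp only [mul_left_comm]
      rw [walkWeight_eq, Function.update_of_ne hsv, Finset.sum_congr rfl branch_eq,
        Finset.sum_add_distrib, Finset.sum_comm, add_assoc]
      simp only [Finset.mul_sum]

end SelfAvoidingWalks

/-- `α` is the positive root of `x ^ 2 = β * x + 1`, with `β` at least `1`. For `β = k - 1` this is
the growth rate of deterministic problems with `k` actions. -/
structure IsMetallicMean (α β : ℝ) : Prop where
  pos : 0 < α
  one_le : 1 ≤ β
  sq_eq : α ^ 2 = β * α + 1

/-- The factor by which a vertex potential shrinks when the light edge of a vertex whose two edges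
are alive is lost. -/
noncomputable def lightLoss (α β : ℝ) : ℝ := (β ^ 2 + 1) / α ^ 2

/-- The factor by which a vertex potential shrinks when the heavy edge of a vertex whose two edges
are alive is lost. -/
noncomputable def heavyLoss (α β : ℝ) : ℝ := 2 * β / α ^ 2

namespace IsMetallicMean

variable {α β : ℝ}

theorem lt (h : IsMetallicMean α β) : β < α := by
  nlinarith [h.pos, h.sq_eq]

theorem one_lt (h : IsMetallicMean α β) : 1 < α :=
  h.one_le.trans_lt h.lt

theorem two_le_natCast {k : ℕ} (h : IsMetallicMean α ((k : ℝ) - 1)) : 2 ≤ k := by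
  exact_mod_cast (by linarith [h.one_le] : (2 : ℝ) ≤ k)

theorem mul_le_sq_add_one (h : IsMetallicMean α β) : β * α ≤ β ^ 2 + 1 := by
  nlinarith [h.lt, h.sq_eq]

theorem le_add_one (h : IsMetallicMean α β) : α ≤ β + 1 := by
  nlinarith [h.lt, h.sq_eq, h.one_le]

theorem cube_eq (h : IsMetallicMean α β) : α ^ 3 = (β ^ 2 + 1) * α + β := by
  linear_combination (α + β) * h.sq_eq

theorem add_le_cube (h : IsMetallicMean α β) : β ^ 3 + 3 * β ≤ α ^ 3 := by
  have key : α * ((β ^ 2 + 1) * (α - β) - β) = β ^ 2 + 1 - β * α := by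
    linear_combination (β ^ 2 + 1) * h.sq_eq
  have : 0 ≤ (β ^ 2 + 1) * (α - β) - β :=
    nonneg_of_mul_nonneg_right (key ▸ sub_nonneg.2 h.mul_le_sq_add_one) h.pos
  linarith [h.cube_eq]

theorem cube_le (h : IsMetallicMean α β) (hβ : 2 ≤ β) : α ^ 3 ≤ 2 * β * (β ^ 2 + 1) := by
  rw [h.cube_eq]
  nlinarith [mul_le_mul_of_nonneg_left h.le_add_one (by positivity : 0 ≤ β ^ 2 + 1)]

theorem one_le_two_mul_div (h : IsMetallicMean α β) : 1 ≤ 2 * β / α := by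
  rw [one_le_div h.pos]
  linarith [h.le_add_one, h.one_le]

theorem two_mul_div_le (h : IsMetallicMean α β) : 2 * β / α ≤ (β ^ 2 + 1) / α := by
  have := h.pos
  gcongr
  nlinarith [sq_nonneg (β - 1)]

theorem sq_add_one_div_le (h : IsMetallicMean α β) : (β ^ 2 + 1) / α ≤ α := by
  rw [div_le_iff₀ h.pos]
  nlinarith [h.sq_eq, h.lt, h.one_le]

theorem lightLoss_pos (h : IsMetallicMean α β) : 0 < lightLoss α β := by
  have := h.pos
  unfold lightLoss
  positivity

theorem lightLoss_mul_sq (h : IsMetallicMean α β) : lightLoss α β * α ^ 2 = β ^ 2 + 1 :=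
  div_mul_cancel₀ _ (pow_ne_zero 2 h.pos.ne')

theorem heavyLoss_mul_sq (h : IsMetallicMean α β) : heavyLoss α β * α ^ 2 = 2 * β :=
  div_mul_cancel₀ _ (pow_ne_zero 2 h.pos.ne')

theorem lightLoss_le_one (h : IsMetallicMean α β) : lightLoss α β ≤ 1 := by
  have := h.pos
  rw [lightLoss, div_le_one (by positivity), h.sq_eq]
  nlinarith [h.lt, h.one_le]

theorem heavyLoss_le_lightLoss (h : IsMetallicMean α β) : heavyLoss α β ≤ lightLoss α β := by
  have := h.pos
  unfold heavyLoss lightLoss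
  gcongr
  nlinarith [sq_nonneg (β - 1)]

theorem mul_heavyLoss_add_lightLoss_le (h : IsMetallicMean α β) :
    β * heavyLoss α β + lightLoss α β ≤ α := by
  have := h.pos
  have cubic : 2 * β ^ 2 + (β ^ 2 + 1) ≤ α ^ 3 := by
    nlinarith [h.add_le_cube, pow_nonneg (sub_nonneg.2 h.one_le) 3]
  refine le_of_mul_le_mul_right ?_ (pow_pos h.pos 2)
  linarith [h.lightLoss_mul_sq, congrArg (β * ·) h.heavyLoss_mul_sq]

theorem mul_lightLoss_add_heavyLoss_le (h : IsMetallicMean α β) :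
    β * lightLoss α β + heavyLoss α β ≤ α := by
  refine le_of_mul_le_mul_right ?_ (pow_pos h.pos 2)
  linarith [h.add_le_cube, h.heavyLoss_mul_sq, congrArg (β * ·) h.lightLoss_mul_sq]

theorem lightLoss_le_half (h : IsMetallicMean α β) : lightLoss α β ≤ α / 2 := by
  refine le_of_mul_le_mul_right ?_ (pow_pos h.pos 2)
  have : 0 ≤ (β - 1) * (β ^ 2 - β + 2) :=
    mul_nonneg (sub_nonneg.2 h.one_le) (by nlinarith [sq_nonneg (β - 1)])
  linarith [h.add_le_cube, h.lightLoss_mul_sq]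

theorem div_le_lightLoss (h : IsMetallicMean α β) (hβ : 2 ≤ β) :
    α / (2 * β) ≤ lightLoss α β := by
  have := h.pos
  rw [lightLoss, div_le_div_iff₀ (by positivity) (by positivity)]
  linarith [h.cube_le hβ]

theorem div_le_heavyLoss (h : IsMetallicMean α β) (hβ : 2 ≤ β) :
    α / (β ^ 2 + 1) ≤ heavyLoss α β := by
  have := h.pos
  rw [heavyLoss, div_le_div_iff₀ (by positivity) (by positivity)]
  linarith [h.cube_le hβ]

theorem lightLoss_mul_le (h : IsMetallicMean α β) :
    lightLoss α β * (α ^ 2 + lightLoss α β) ≤ α ^ 2 := by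
  have hα := h.pos
  have key : α * (β * ((β ^ 2 + 1) * α + β) - (β ^ 2 + 1) ^ 2) = β * (β ^ 2 + 1) - α := by
    linear_combination β * (β ^ 2 + 1) * h.sq_eq
  have sq_le : (β ^ 2 + 1) ^ 2 ≤ β * α ^ 3 := by
    rw [h.cube_eq]
    refine sub_nonneg.1 (nonneg_of_mul_nonneg_right ?_ hα)
    rw [key]
    nlinarith [h.le_add_one, h.one_le]
  refine le_of_mul_le_mul_right ?_ (pow_pos hα 4)
  calc lightLoss α β * (α ^ 2 + lightLoss α β) * α ^ 4
      = lightLoss α β * α ^ 2 * α ^ 4 + (lightLoss α β * α ^ 2) ^ 2 := by ring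
    _ = (β ^ 2 + 1) * α ^ 4 + (β ^ 2 + 1) ^ 2 := by rw [h.lightLoss_mul_sq]
    _ ≤ (β ^ 2 + 1) * α ^ 4 + β * α ^ 3 := by gcongr
    _ = α ^ 2 * α ^ 4 := by linear_combination -α ^ 3 * h.cube_eq

theorem lightLoss_pow_mul_le (h : IsMetallicMean α β) (i : ℕ) :
    lightLoss α β ^ (i + 1) * (α ^ 2 + lightLoss α β + i) ≤ α ^ 2 := by
  have hρ := h.lightLoss_pos
  have hρ1 := h.lightLoss_le_one
  induction i with
  | zero => simpa using h.lightLoss_mul_le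
  | succ i ih =>
    refine le_trans ?_ ih
    rw [pow_succ, mul_assoc]
    gcongr
    push_cast
    nlinarith [h.lightLoss_mul_le, mul_nonneg i.cast_nonneg (sub_nonneg.2 hρ1)]

theorem light_neighbors_bound (h : IsMetallicMean α β) {c p : ℝ} (hp : 0 ≤ p) (hpα : p ≤ α)
    (hc : β * c + 1 ≤ α * p) (i : ℕ) :
    β * (c * lightLoss α β ^ (i + 1)) + lightLoss α β *
      (lightLoss α β ^ (i + 1) * (1 + (i + 1) * (p / (lightLoss α β * α)))) ≤ α * p := by
  have hα := h.pos
  have hρ := h.lightLoss_pos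
  have hρ1 := h.lightLoss_le_one
  have bracket_le :
      β * c + lightLoss α β + (i + 1) * (p / α) ≤ (α ^ 2 + lightLoss α β + i) * (p / α) := by
    have : (1 - lightLoss α β) * (p / α) ≤ 1 - lightLoss α β :=
      mul_le_of_le_one_right (sub_nonneg.2 hρ1) ((div_le_one hα).2 hpα)
    have : α ^ 2 * (p / α) = α * p := by field_simp
    linarith
  calc _ = lightLoss α β ^ (i + 1) * (β * c + lightLoss α β + (i + 1) * (p / α)) := by
        field_simp
        ring
    _ ≤ lightLoss α β ^ (i + 1) * ((α ^ 2 + lightLoss α β + i) * (p / α)) := by gcongr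
    _ = lightLoss α β ^ (i + 1) * (α ^ 2 + lightLoss α β + i) * (p / α) := by ring
    _ ≤ α ^ 2 * (p / α) := by
      have := h.lightLoss_pow_mul_le i
      gcongr
    _ = α * p := by field_simp

theorem shared_light_neighbor_bound (h : IsMetallicMean α β) {c p : ℝ} (hp : 0 ≤ p)
    (hc : β * (β + c) + p ≤ (β * α + lightLoss α β) * p) (i : ℕ) :
    β * ((β + c) * lightLoss α β ^ (i + 1)) +
      lightLoss α β ^ (i + 1) * (1 + (i + 1)) * p ≤ α ^ 2 * p := by
  have hρ := h.lightLoss_pos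
  calc _ = lightLoss α β ^ (i + 1) * (β * (β + c) + p + (i + 1) * p) := by ring
    _ ≤ lightLoss α β ^ (i + 1) * ((β * α + lightLoss α β) * p + (i + 1) * p) := by gcongr
    _ = lightLoss α β ^ (i + 1) * (α ^ 2 + lightLoss α β + i) * p := by rw [h.sq_eq]; ring
    _ ≤ α ^ 2 * p := mul_le_mul_of_nonneg_right (h.lightLoss_pow_mul_le i) hp

theorem mutual_light_neighbor_bound (h : IsMetallicMean α β) (hβ : 2 ≤ β) (i : ℕ) :
    β * ((β + α) * lightLoss α β ^ i) +
      lightLoss α β ^ (i + 1) * (1 + (i + 1)) * α ≤ α ^ 2 * α := by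
  have hα := h.pos
  have hρ := h.lightLoss_pos
  have bracket_le : β * (β + α) + lightLoss α β * (2 * α) ≤
      lightLoss α β * (α ^ 2 + lightLoss α β) * α := by
    have expand : lightLoss α β * (α ^ 2 + lightLoss α β) * α =
        (β ^ 2 + 1 + lightLoss α β ^ 2) * α := by
      linear_combination α * h.lightLoss_mul_sq
    have : β * (β + α) ≤ β ^ 2 * α := by
      have hβ0 : 0 < β := by linarith
      nlinarith [mul_pos hβ0 (sub_pos.2 h.lt), mul_nonneg (mul_pos hβ0 hα).le (sub_nonneg.2 hβ)]
    linarith [mul_nonneg (sq_nonneg (lightLoss α β - 1)) hα.le]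
  calc _ = lightLoss α β ^ i * (β * (β + α) + lightLoss α β * (2 * α) +
        lightLoss α β * i * α) := by ring
    _ ≤ lightLoss α β ^ i * (lightLoss α β * (α ^ 2 + lightLoss α β) * α +
        lightLoss α β * i * α) := by gcongr
    _ = lightLoss α β ^ (i + 1) * (α ^ 2 + lightLoss α β + i) * α := by ring
    _ ≤ α ^ 2 * α := mul_le_mul_of_nonneg_right (h.lightLoss_pow_mul_le i) hα.le

end IsMetallicMean

/-- The outgoing edges of a vertex in an extremal weighted graph: either the exit, with weight `1`,
or a heavy edge of weight `β` and a light edge of weight `1` to distinct vertices. -/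
inductive ExtremalRow (V : Type*)
  | exit
  | edges (heavy light : V) (ne : heavy ≠ light)

namespace ExtremalRow

variable {V : Type*}

/-- The row `R` has a light edge to `u`, and the end points of both its edges lie in `Y`. -/
def IsFullLightTo (R : ExtremalRow V) (Y : Finset V) (u : V) : Prop :=
  ∃ (a : V) (ne : a ≠ u), R = .edges a u ne ∧ a ∈ Y ∧ u ∈ Y

theorem IsFullLightTo.mono {R : ExtremalRow V} {Y Z : Finset V} {u : V}
    (hR : R.IsFullLightTo Y u) (hYZ : Y ⊆ Z) : R.IsFullLightTo Z u := by
  obtain ⟨a, ne, hr, ha, hu⟩ := hR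
  exact ⟨a, ne, hr, hYZ ha, hYZ hu⟩

variable [DecidableEq V]

/-- The weights of the edges of an extremal row, as a row of the weights of `walkWeight`. -/
def weight (β : ℝ) : ExtremalRow V → Option V → ℝ
  | exit, o => if o = none then 1 else 0
  | edges h l _, o => (if o = some h then β else 0) + if o = some l then 1 else 0

/-- The end points of the edges of an extremal row. -/
def targets : ExtremalRow V → Finset V
  | exit => ∅
  | edges h l _ => {h, l}

/-- How much an extremal row contributes to the bound on the walks which start with it and continue
inside `Y`. An edge to a vertex outside `Y` is dead. -/
noncomputable def capacity (α β : ℝ) (Y : Finset V) : ExtremalRow V → ℝ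
  | exit => 1
  | edges h l _ => if h ∈ Y then if l ∈ Y then α else β else if l ∈ Y then 1 else 0

/-- How much an extremal row contributes to the bound on the walks which may pass through its
vertex and continue inside `Y`. -/
noncomputable def potential (α β : ℝ) (Y : Finset V) : ExtremalRow V → ℝ
  | exit => 2 * β / α
  | edges h l _ =>
    if h ∈ Y then if l ∈ Y then α else (β ^ 2 + 1) / α else if l ∈ Y then 2 * β / α else 1

theorem weight_exit (β : ℝ) : (exit : ExtremalRow V).weight β = Pi.single none 1 := by
  funext o
  rw [weight, Pi.single_apply]

theorem weight_of_notMem_targets (β : ℝ) {R : ExtremalRow V} {u : V} (hu : u ∉ R.targets) :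
    R.weight β (some u) = 0 := by
  cases R <;> simp_all [weight, targets]

theorem exists_eq_edges_of_mem_targets {R : ExtremalRow V} {u : V} (hu : u ∈ R.targets) :
    (∃ (b : V) (ne : u ≠ b), R = edges u b ne) ∨ ∃ (a : V) (ne : a ≠ u), R = edges a u ne := by
  cases R with
  | exit => simp [targets] at hu
  | edges a b ne =>
    obtain rfl | rfl : u = a ∨ u = b := by simpa [targets] using hu
    · exact .inl ⟨b, ne, rfl⟩
    · exact .inr ⟨a, ne, rfl⟩

variable {α β : ℝ}

theorem weight_nonneg (hβ : 0 ≤ β) (R : ExtremalRow V) (o : Option V) : 0 ≤ R.weight β o := by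
  cases R <;> unfold weight <;> positivity

theorem capacity_potential_cases (α β : ℝ) (Y : Finset V) (R : ExtremalRow V) :
    (R.capacity α β Y = α ∧ R.potential α β Y = α) ∨
      (R.capacity α β Y = β ∧ R.potential α β Y = (β ^ 2 + 1) / α) ∨
      (R.capacity α β Y = 1 ∧ R.potential α β Y = 2 * β / α) ∨
      (R.capacity α β Y = 0 ∧ R.potential α β Y = 1) := by
  cases R with
  | exit => simp [capacity, potential]
  | edges u v =>
    simp only [capacity, potential]
    split_ifs <;> simp

theorem capacity_le (h : IsMetallicMean α β) (Y : Finset V) (R : ExtremalRow V) :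
    R.capacity α β Y ≤ α := by
  have := h.lt
  have := h.one_lt
  rcases capacity_potential_cases α β Y R with ⟨hc, -⟩ | ⟨hc, -⟩ | ⟨hc, -⟩ | ⟨hc, -⟩ <;> linarith

theorem capacity_nonneg (h : IsMetallicMean α β) (Y : Finset V) (R : ExtremalRow V) :
    0 ≤ R.capacity α β Y := by
  have := h.lt
  have := h.one_le
  rcases capacity_potential_cases α β Y R with ⟨hc, -⟩ | ⟨hc, -⟩ | ⟨hc, -⟩ | ⟨hc, -⟩ <;> linarith

theorem capacity_mono (h : IsMetallicMean α β) {Y Z : Finset V} (hYZ : Y ⊆ Z)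
    (R : ExtremalRow V) : R.capacity α β Y ≤ R.capacity α β Z := by
  have := h.lt
  have := h.one_le
  cases R with
  | exit => rfl
  | edges u v =>
    have hu := @hYZ u
    have hv := @hYZ v
    simp only [capacity]
    split_ifs <;> first | linarith | tauto

theorem potential_mono (h : IsMetallicMean α β) {Y Z : Finset V} (hYZ : Y ⊆ Z)
    (R : ExtremalRow V) : R.potential α β Y ≤ R.potential α β Z := by
  have := h.one_le_two_mul_div
  have := h.two_mul_div_le
  have := h.sq_add_one_div_le
  cases R with
  | exit => rfl
  | edges u v =>
    have hu := @hYZ u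
    have hv := @hYZ v
    simp only [potential]
    split_ifs <;> first | linarith | tauto

section Potential

variable (h : IsMetallicMean α β) (Y : Finset V) (R : ExtremalRow V)

include h

theorem one_le_potential : 1 ≤ R.potential α β Y := by
  have := h.one_le_two_mul_div
  have := h.two_mul_div_le
  have := h.one_lt
  rcases capacity_potential_cases α β Y R with ⟨-, hp⟩ | ⟨-, hp⟩ | ⟨-, hp⟩ | ⟨-, hp⟩ <;> linarith

theorem potential_pos : 0 < R.potential α β Y :=
  zero_lt_one.trans_le (one_le_potential h Y R)

theorem potential_le : R.potential α β Y ≤ α := by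
  have := h.two_mul_div_le
  have := h.sq_add_one_div_le
  have := h.one_lt
  rcases capacity_potential_cases α β Y R with ⟨-, hp⟩ | ⟨-, hp⟩ | ⟨-, hp⟩ | ⟨-, hp⟩ <;> linarith

theorem mul_capacity_add_one_le : β * R.capacity α β Y + 1 ≤ α * R.potential α β Y := by
  have := h.sq_eq
  have := h.one_le
  rcases capacity_potential_cases α β Y R with ⟨hc, hp⟩ | ⟨hc, hp⟩ | ⟨hc, hp⟩ | ⟨hc, hp⟩ <;>
    rw [hc, hp] <;> try rw [mul_div_cancel₀ _ h.pos.ne']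
  all_goals linarith [h.one_lt]

theorem add_capacity_le : β + R.capacity α β Y ≤ α * R.potential α β Y := by
  have := h.lt
  have := h.one_le
  have := h.sq_eq
  rcases capacity_potential_cases α β Y R with ⟨hc, hp⟩ | ⟨hc, hp⟩ | ⟨hc, hp⟩ | ⟨hc, hp⟩ <;>
    rw [hc, hp] <;> try rw [mul_div_cancel₀ _ h.pos.ne']
  all_goals nlinarith

theorem capacity_le_potential : R.capacity α β Y ≤ R.potential α β Y := by
  refine le_of_mul_le_mul_left ?_ h.pos
  rcases capacity_potential_cases α β Y R with ⟨hc, hp⟩ | ⟨hc, hp⟩ | ⟨hc, hp⟩ | ⟨hc, hp⟩ <;>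
    rw [hc, hp] <;> try rw [mul_div_cancel₀ _ h.pos.ne']
  all_goals nlinarith [h.mul_le_sq_add_one, h.le_add_one, h.one_le, h.pos]

theorem mul_add_capacity_add_potential_le (hβ : 2 ≤ β) :
    β * (β + R.capacity α β Y) + R.potential α β Y ≤
      (β * α + lightLoss α β) * R.potential α β Y := by
  have hα := h.pos
  have gap_eq : (1 - lightLoss α β) * α ^ 2 = β * (α - β) := by
    linear_combination h.sq_eq - h.lightLoss_mul_sq
  have gap_nonneg : 0 ≤ 1 - lightLoss α β := sub_nonneg.2 h.lightLoss_le_one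
  have gap_le : 1 - lightLoss α β ≤ β * (α - β) := by
    rw [← gap_eq]
    exact le_mul_of_one_le_right gap_nonneg (one_le_pow₀ h.one_lt.le)
  have gap_mul_potential_le : (1 - lightLoss α β) * R.potential α β Y ≤ 1 := by
    have := mul_le_mul_of_nonneg_left (potential_le h Y R) gap_nonneg
    nlinarith [h.mul_le_sq_add_one, h.one_lt]
  have sq_le : 2 * β ≤ β ^ 2 := by nlinarith
  rcases capacity_potential_cases α β Y R with ⟨hc, hp⟩ | ⟨hc, hp⟩ | ⟨hc, hp⟩ | ⟨hc, hp⟩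
  · rw [hc, hp] at *
    have := h.sq_eq
    have := mul_le_mul_of_nonneg_left h.lt.le (by linarith : 0 ≤ β ^ 2 - β)
    nlinarith
  · have : β * α * R.potential α β Y = β * (β ^ 2 + 1) := by rw [hp]; field_simp
    rw [hc]
    nlinarith
  · have : β * α * R.potential α β Y = β * (2 * β) := by rw [hp]; field_simp
    rw [hc]
    nlinarith
  · rw [hc, hp]
    linarith

end Potential

section Loss

variable (h : IsMetallicMean α β) {Y : Finset V} {u v : V}

include h

theorem potential_erase_heavy (hu : u ∈ Y) (hv : v ∈ Y) (ne : u ≠ v) :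
    (edges u v ne).potential α β (Y.erase u) =
      heavyLoss α β * (edges u v ne).potential α β Y := by
  have hα := h.pos
  simp only [potential, Finset.mem_erase, ne_eq, not_true_eq_false, hu, and_true, ↓reduceIte,
    ne.symm, not_false_eq_true, hv, and_self, heavyLoss]
  field_simp

theorem potential_erase_sole_heavy (hu : u ∈ Y) (hv : v ∉ Y) (ne : u ≠ v) :
    (edges u v ne).potential α β (Y.erase u) =
      α / (β ^ 2 + 1) * (edges u v ne).potential α β Y := by
  have hα := h.pos
  simp only [potential, Finset.mem_erase, ne_eq, not_true_eq_false, hu, and_true, ↓reduceIte, hv,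
    and_false]
  field_simp

theorem potential_erase_light (hu : u ∈ Y) (hv : v ∈ Y) (ne : u ≠ v) :
    (edges u v ne).potential α β (Y.erase v) =
      lightLoss α β * (edges u v ne).potential α β Y := by
  have hα := h.pos
  simp only [potential, Finset.mem_erase, ne_eq, ne, not_false_eq_true, hu, and_self, ↓reduceIte,
    not_true_eq_false, hv, and_true, lightLoss]
  field_simp

theorem potential_erase_sole_light (hu : u ∉ Y) (hv : v ∈ Y) (ne : u ≠ v) :
    (edges u v ne).potential α β (Y.erase v) =
      α / (2 * β) * (edges u v ne).potential α β Y := by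
  have hα := h.pos
  have hβ := h.one_le
  simp only [potential, Finset.mem_erase, ne_eq, hu, and_false, ↓reduceIte, not_true_eq_false, hv,
    and_true]
  field_simp

theorem potential_erase_heavy_le (hβ : 2 ≤ β) (hu : u ∈ Y) (ne : u ≠ v) :
    (edges u v ne).potential α β (Y.erase u) ≤
      heavyLoss α β * (edges u v ne).potential α β Y := by
  by_cases hv : v ∈ Y
  · exact (potential_erase_heavy h hu hv ne).le
  · rw [potential_erase_sole_heavy h hu hv]
    exact mul_le_mul_of_nonneg_right (h.div_le_heavyLoss hβ) (potential_pos h _ _).le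

theorem potential_erase_le {c : ℝ} (light_le : lightLoss α β ≤ c) (sole_le : α / (2 * β) ≤ c)
    (hu : u ∈ Y) {R : ExtremalRow V} (hR : u ∈ R.targets) :
    R.potential α β (Y.erase u) ≤ c * R.potential α β Y := by
  have pos := (potential_pos h Y R).le
  obtain ⟨b, ne, rfl⟩ | ⟨a, ne, rfl⟩ := exists_eq_edges_of_mem_targets hR
  · by_cases hb : b ∈ Y
    · rw [potential_erase_heavy h hu hb]
      exact mul_le_mul_of_nonneg_right (h.heavyLoss_le_lightLoss.trans light_le) pos
    · rw [potential_erase_sole_heavy h hu hb]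
      have : α / (β ^ 2 + 1) ≤ α / (2 * β) := by
        have := h.pos
        have := h.one_le
        gcongr
        nlinarith [sq_nonneg (β - 1)]
      exact mul_le_mul_of_nonneg_right (this.trans sole_le) pos
  · by_cases ha : a ∈ Y
    · rw [potential_erase_light h ha hu]
      exact mul_le_mul_of_nonneg_right light_le pos
    · rw [potential_erase_sole_light h ha hu]
      exact mul_le_mul_of_nonneg_right sole_le pos

end Loss

end ExtremalRow

theorem prod_le_prod_mul_prod {ι : Type*} [DecidableEq ι] {s t : Finset ι} (hts : t ⊆ s)
    {f g c : ι → ℝ} (hf : ∀ i ∈ s, 0 ≤ f i) (hfg : ∀ i ∈ s \ t, f i ≤ g i)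
    (hc : ∀ i ∈ t, f i ≤ c i * g i) : ∏ i ∈ s, f i ≤ (∏ i ∈ t, c i) * ∏ i ∈ s, g i := by
  rw [← Finset.prod_sdiff hts, ← Finset.prod_sdiff hts, mul_left_comm, ← Finset.prod_mul_distrib]
  have hf' : ∀ i ∈ s \ t, 0 ≤ f i := fun i hi => hf i (Finset.sdiff_subset hi)
  exact mul_le_mul (Finset.prod_le_prod hf' hfg)
    (Finset.prod_le_prod (fun i hi => hf i (hts hi)) hc)
    (Finset.prod_nonneg fun i hi => hf i (hts hi))
    (Finset.prod_nonneg fun i hi => (hf' i hi).trans (hfg i hi))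

section WalkBounds

variable {V : Type*} [DecidableEq V] {α β : ℝ} {r : V → ExtremalRow V} {X : Finset V} {s u w : V}

/-- The weights of the edges of the graph whose vertices have the extremal rows `r`. -/
def rowWeights (β : ℝ) (r : V → ExtremalRow V) (v : V) : Option V → ℝ :=
  (r v).weight β

/-- The potential of the vertex `v` in the subgraph on `X`. As a self-avoiding walk does not use
loops, these do not count as alive. -/
noncomputable def vertexPotential (α β : ℝ) (r : V → ExtremalRow V) (X : Finset V) (v : V) : ℝ :=
  (r v).potential α β (X.erase v)

/-- The vertices of `X` other than `u` with an edge to `u`. -/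
def inNeighbors (r : V → ExtremalRow V) (X : Finset V) (u : V) : Finset V :=
  {v ∈ X.erase u | u ∈ (r v).targets}

/-- The bound on the weight of the self-avoiding walks inside `X` which is proved by induction on
`X`. -/
def WalkBound (α β : ℝ) (X : Finset V) : Prop :=
  ∀ (r : V → ExtremalRow V) (s : V), s ∉ X → walkWeight (rowWeights β r) X s ≤
    (r s).capacity α β X * ∏ v ∈ X, vertexPotential α β r X v

theorem mem_inNeighbors {v : V} :
    v ∈ inNeighbors r X u ↔ v ∈ X.erase u ∧ u ∈ (r v).targets := by
  simp only [inNeighbors, Finset.mem_filter]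

theorem mem_erase_of_mem_inNeighbors (hu : u ∈ X) {v : V} (hv : v ∈ inNeighbors r X u) :
    u ∈ X.erase v :=
  Finset.mem_erase.2 ⟨(Finset.ne_of_mem_erase (mem_inNeighbors.1 hv).1).symm, hu⟩

theorem rowWeights_update (β : ℝ) (r : V → ExtremalRow V) (v : V) (R : ExtremalRow V) :
    rowWeights β (Function.update r v R) = Function.update (rowWeights β r) v (R.weight β) := by
  funext y
  obtain rfl | hy := eq_or_ne y v
  · simp [rowWeights]
  · simp [rowWeights, hy]

theorem walkWeight_of_edges {a b : V} {ne : a ≠ b} (hs : r s = .edges a b ne) (X : Finset V) :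
    walkWeight (rowWeights β r) X s =
      (if a ∈ X then β * walkWeight (rowWeights β r) (X.erase a) a else 0) +
        if b ∈ X then walkWeight (rowWeights β r) (X.erase b) b else 0 := by
  rw [walkWeight_eq]
  simp [rowWeights, hs, ExtremalRow.weight, add_mul, Finset.sum_add_distrib, ite_mul]

theorem vertexPotential_of_isFullLightTo (α β : ℝ) {v : V}
    (hv : (r v).IsFullLightTo (X.erase v) u) : vertexPotential α β r X v = α := by
  obtain ⟨a, ne, hr, ha, hu⟩ := hv
  rw [vertexPotential, hr, ExtremalRow.potential, if_pos ha, if_pos hu]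

section

variable (h : IsMetallicMean α β)

include h

theorem rowWeights_nonneg (r : V → ExtremalRow V) (v : V) (o : Option V) :
    0 ≤ rowWeights β r v o :=
  ExtremalRow.weight_nonneg (zero_le_one.trans h.one_le) _ _

theorem vertexPotential_pos (r : V → ExtremalRow V) (X : Finset V) (v : V) :
    0 < vertexPotential α β r X v :=
  ExtremalRow.potential_pos h _ _

theorem prod_vertexPotential_pos (r : V → ExtremalRow V) (X Y : Finset V) :
    0 < ∏ v ∈ Y, vertexPotential α β r X v :=
  Finset.prod_pos fun v _ => vertexPotential_pos h r X v

theorem vertexPotential_mono (r : V → ExtremalRow V) {Y : Finset V} (hXY : X ⊆ Y) (v : V) :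
    vertexPotential α β r X v ≤ vertexPotential α β r Y v :=
  ExtremalRow.potential_mono h (Finset.erase_subset_erase v hXY) _

theorem prod_vertexPotential_mono (r : V → ExtremalRow V) {Y : Finset V} (hXY : X ⊆ Y)
    (T : Finset V) :
    ∏ v ∈ T, vertexPotential α β r X v ≤ ∏ v ∈ T, vertexPotential α β r Y v :=
  Finset.prod_le_prod (fun v _ => (vertexPotential_pos h r X v).le)
    fun v _ => vertexPotential_mono h r hXY v

theorem prod_vertexPotential_le_of_loss {Y N T : Finset V} (hXY : X ⊆ Y) (hNT : N ⊆ T) {c : V → ℝ}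
    (hN : ∀ v ∈ N, vertexPotential α β r X v ≤ c v * vertexPotential α β r Y v) :
    ∏ v ∈ T, vertexPotential α β r X v ≤
      (∏ v ∈ N, c v) * ∏ v ∈ T, vertexPotential α β r Y v :=
  prod_le_prod_mul_prod hNT (fun v _ => (vertexPotential_pos h r X v).le)
    (fun v _ => vertexPotential_mono h r hXY v) hN

theorem vertexPotential_erase_le_of_mem_inNeighbors {c : ℝ} (light_le : lightLoss α β ≤ c)
    (sole_le : α / (2 * β) ≤ c) (hu : u ∈ X) {v : V} (hv : v ∈ inNeighbors r X u) :
    vertexPotential α β r (X.erase u) v ≤ c * vertexPotential α β r X v := by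
  rw [vertexPotential, Finset.erase_right_comm]
  exact ExtremalRow.potential_erase_le h light_le sole_le (mem_erase_of_mem_inNeighbors hu hv)
    (mem_inNeighbors.1 hv).2

theorem vertexPotential_erase_le_of_heavy (hβ : 2 ≤ β) (hu : u ∈ X) {v b : V}
    (hv : v ∈ inNeighbors r X u) {ne : u ≠ b} (hr : r v = .edges u b ne) :
    vertexPotential α β r (X.erase u) v ≤ heavyLoss α β * vertexPotential α β r X v := by
  rw [vertexPotential, vertexPotential, Finset.erase_right_comm, hr]
  exact ExtremalRow.potential_erase_heavy_le h hβ (mem_erase_of_mem_inNeighbors hu hv) ne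

theorem walkWeight_le_erase_of_inNeighbors_eq_empty (hw : w ∈ X) (hu : u ∈ X) (huw : u ≠ w)
    (hN : inNeighbors r X u = ∅) :
    walkWeight (rowWeights β r) (X.erase w) w ≤
      walkWeight (rowWeights β r) ((X.erase u).erase w) w := by
  rw [Finset.erase_right_comm]
  refine walkWeight_le_erase (rowWeights_nonneg h r) (Finset.notMem_erase w X)
    (Finset.mem_erase.2 ⟨huw, hu⟩) fun v hv => ?_
  rw [Finset.insert_erase hw] at hv
  refine ExtremalRow.weight_of_notMem_targets β fun hvu => ?_
  exact Finset.notMem_empty v (hN ▸ mem_inNeighbors.2 ⟨hv, hvu⟩)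

namespace WalkBound

theorem le_prod_insert (hX : WalkBound α β X) (r : V → ExtremalRow V) (hs : s ∉ X) :
    walkWeight (rowWeights β r) X s ≤ ∏ v ∈ insert s X, vertexPotential α β r X v := by
  rw [Finset.prod_insert hs, vertexPotential, Finset.erase_eq_of_notMem hs]
  exact (hX r s hs).trans (mul_le_mul_of_nonneg_right (ExtremalRow.capacity_le_potential h _ _)
    (prod_vertexPotential_pos h r _ _).le)

theorem le_prod (hX : WalkBound α β (X.erase s)) (r : V → ExtremalRow V) (hs : s ∈ X) :
    walkWeight (rowWeights β r) (X.erase s) s ≤ ∏ v ∈ X, vertexPotential α β r X v := by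
  have := hX.le_prod_insert h r (Finset.notMem_erase s X)
  rw [Finset.insert_erase hs] at this
  exact this.trans (prod_vertexPotential_mono h r (Finset.erase_subset s X) _)

theorem le_mul_prod_of_loss (hX : WalkBound α β (X.erase s)) (hs : s ∈ X) {v : V}
    (hv : v ∈ inNeighbors r X s) {c : ℝ}
    (hc : vertexPotential α β r (X.erase s) v ≤ c * vertexPotential α β r X v) :
    walkWeight (rowWeights β r) (X.erase s) s ≤ c * ∏ v ∈ X, vertexPotential α β r X v := by
  have loss := prod_vertexPotential_le_of_loss h (r := r) (Finset.erase_subset s X)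
    (Finset.singleton_subset_iff.2 (mem_inNeighbors.1 hv).1) (c := fun _ => c)
    (by simpa only [Finset.mem_singleton, forall_eq] using hc)
  rw [Finset.prod_singleton] at loss
  rw [← Finset.mul_prod_erase _ _ hs, mul_left_comm]
  exact (hX r s (Finset.notMem_erase s X)).trans (mul_le_mul
    (ExtremalRow.capacity_le_potential h _ _) loss
    (prod_vertexPotential_pos h r _ _).le (vertexPotential_pos h r X s).le)

theorem branches_le_of_heavy_isolated (ih : ∀ Y ⊂ X, WalkBound α β Y) (hu : u ∈ X) (hw : w ∈ X)
    (huw : u ≠ w) (hN : inNeighbors r X u = ∅) :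
    β * walkWeight (rowWeights β r) (X.erase u) u + walkWeight (rowWeights β r) (X.erase w) w ≤
      α * ∏ v ∈ X, vertexPotential α β r X v := by
  have hwu : w ∈ X.erase u := Finset.mem_erase.2 ⟨huw.symm, hw⟩
  set K := ∏ v ∈ X.erase u, vertexPotential α β r (X.erase u) v
  have heavy_le := ih _ (Finset.erase_ssubset hu) r u (Finset.notMem_erase u X)
  have light_le : walkWeight (rowWeights β r) (X.erase w) w ≤ K :=
    (walkWeight_le_erase_of_inNeighbors_eq_empty h hw hu huw hN).trans
      (le_prod h (ih _ ((Finset.erase_ssubset hwu).trans (Finset.erase_ssubset hu))) r hwu)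
  have := h.pos
  have := h.one_le
  have hK : 0 < K := prod_vertexPotential_pos h r _ _
  calc _ ≤ β * ((r u).capacity α β (X.erase u) * K) + K := by gcongr
    _ = (β * (r u).capacity α β (X.erase u) + 1) * K := by ring
    _ ≤ α * vertexPotential α β r X u * K :=
      mul_le_mul_of_nonneg_right (ExtremalRow.mul_capacity_add_one_le h _ _) hK.le
    _ ≤ α * vertexPotential α β r X u * ∏ v ∈ X.erase u, vertexPotential α β r X v :=
      mul_le_mul_of_nonneg_left (prod_vertexPotential_mono h r (Finset.erase_subset u X) _)
        (mul_nonneg h.pos.le (vertexPotential_pos h r X u).le)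
    _ = _ := by rw [mul_assoc, Finset.mul_prod_erase _ _ hu]

theorem branches_le_mul_of_light_isolated (ih : ∀ Y ⊂ X, WalkBound α β Y) (hu : u ∈ X)
    (hw : w ∈ X) (huw : u ≠ w) (hN : inNeighbors r X w = ∅) :
    β * walkWeight (rowWeights β r) (X.erase u) u + walkWeight (rowWeights β r) (X.erase w) w ≤
      (β + (r w).capacity α β (X.erase w)) *
        ∏ v ∈ X.erase w, vertexPotential α β r (X.erase w) v := by
  have huw' : u ∈ X.erase w := Finset.mem_erase.2 ⟨huw, hu⟩
  set K := ∏ v ∈ X.erase w, vertexPotential α β r (X.erase w) v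
  have heavy_le : walkWeight (rowWeights β r) (X.erase u) u ≤ K :=
    (walkWeight_le_erase_of_inNeighbors_eq_empty h hu hw huw.symm hN).trans
      (le_prod h (ih _ ((Finset.erase_ssubset huw').trans (Finset.erase_ssubset hw))) r huw')
  have light_le := ih _ (Finset.erase_ssubset hw) r w (Finset.notMem_erase w X)
  rw [add_mul]
  exact add_le_add (mul_le_mul_of_nonneg_left heavy_le (zero_le_one.trans h.one_le)) light_le

theorem branches_le_of_light_isolated (ih : ∀ Y ⊂ X, WalkBound α β Y) (hu : u ∈ X)
    (hw : w ∈ X) (huw : u ≠ w) (hN : inNeighbors r X w = ∅) :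
    β * walkWeight (rowWeights β r) (X.erase u) u + walkWeight (rowWeights β r) (X.erase w) w ≤
      α * ∏ v ∈ X, vertexPotential α β r X v := by
  refine (branches_le_mul_of_light_isolated h ih hu hw huw hN).trans ?_
  rw [← Finset.mul_prod_erase _ _ hw, ← mul_assoc]
  exact mul_le_mul (ExtremalRow.add_capacity_le h _ _)
    (prod_vertexPotential_mono h r (Finset.erase_subset w X) _)
    (prod_vertexPotential_pos h r _ _).le (mul_nonneg h.pos.le (vertexPotential_pos h r X w).le)

end WalkBound

theorem vertexPotential_erase_of_isFullLightTo {v : V} (hv : (r v).IsFullLightTo (X.erase v) u) :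
    vertexPotential α β r (X.erase u) v = lightLoss α β * vertexPotential α β r X v := by
  obtain ⟨a, ne, hr, ha, hu⟩ := hv
  rw [vertexPotential, vertexPotential, Finset.erase_right_comm, hr,
    ExtremalRow.potential_erase_light h ha hu]

theorem prod_vertexPotential_erase_le_pow {N T : Finset V} (hNT : N ⊆ T)
    (hN : ∀ v ∈ N, (r v).IsFullLightTo (X.erase v) u) :
    ∏ v ∈ T, vertexPotential α β r (X.erase u) v ≤
      lightLoss α β ^ N.card * ∏ v ∈ T, vertexPotential α β r X v := by
  rw [← Finset.prod_const]
  exact prod_vertexPotential_le_of_loss h (Finset.erase_subset u X) hNT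
    fun v hv => (vertexPotential_erase_of_isFullLightTo h (hN v hv)).le

namespace WalkBound

theorem walkWeight_update_le (hX : WalkBound α β (X.erase u)) (hs : s ∉ X) {N : Finset V}
    (hNX : N ⊆ insert s (X.erase u)) (hN : ∀ v ∈ N, (r v).IsFullLightTo (X.erase v) u) {v : V}
    (hv : v ∈ N) :
    walkWeight (Function.update (rowWeights β r) v (rowWeights β r u)) (X.erase u) s ≤
      vertexPotential α β r X u / (lightLoss α β * α) *
        (lightLoss α β ^ N.card * ∏ y ∈ insert s (X.erase u), vertexPotential α β r X y) := by
  set D := insert s (X.erase u)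
  set r' := Function.update r v (r u)
  have hρ := h.lightLoss_pos
  have hα := h.pos
  have head_le : vertexPotential α β r' (X.erase u) v ≤ vertexPotential α β r X u := by
    simp only [vertexPotential, r', Function.update_self]
    exact ExtremalRow.potential_mono h (Finset.erase_subset _ _) _
  have rest_le : ∏ y ∈ D.erase v, vertexPotential α β r' (X.erase u) y ≤
      lightLoss α β ^ (N.erase v).card * ∏ y ∈ D.erase v, vertexPotential α β r X y := by
    refine le_of_eq_of_le (Finset.prod_congr rfl fun y hy => ?_)
      (prod_vertexPotential_erase_le_pow h (Finset.erase_subset_erase v hNX)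
        fun y hy => hN y (Finset.mem_of_mem_erase hy))
    simp only [vertexPotential, r', Function.update_of_ne (Finset.ne_of_mem_erase hy)]
  have bound := hX.le_prod_insert h r' fun hsX => hs (Finset.mem_of_mem_erase hsX)
  rw [rowWeights_update] at bound
  refine bound.trans ?_
  rw [← Finset.mul_prod_erase _ _ (hNX hv), ← Finset.mul_prod_erase D _ (hNX hv),
    vertexPotential_of_isFullLightTo α β (hN v hv), ← Finset.card_erase_add_one hv, pow_succ]
  calc _ ≤ vertexPotential α β r X u * (lightLoss α β ^ (N.erase v).card *
        ∏ y ∈ D.erase v, vertexPotential α β r X y) :=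
      mul_le_mul head_le rest_le (prod_vertexPotential_pos h _ _ _).le
        (vertexPotential_pos h r X u).le
    _ = _ := by field_simp

theorem walkWeight_le_of_light_neighbors (hX : WalkBound α β (X.erase u)) (hs : s ∉ X)
    (hu : u ∈ X) (hN : ∀ v ∈ inNeighbors r (insert s X) u, (r v).IsFullLightTo (X.erase v) u) :
    walkWeight (rowWeights β r) X s ≤
      lightLoss α β ^ (inNeighbors r (insert s X) u).card *
        (1 + (inNeighbors r (insert s X) u).card *
          (vertexPotential α β r X u / (lightLoss α β * α))) *
        ∏ v ∈ insert s (X.erase u), vertexPotential α β r X v := by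
  set N := inNeighbors r (insert s X) u
  have hsu : s ≠ u := fun e => hs (e ▸ hu)
  have hD : (insert s X).erase u = insert s (X.erase u) := Finset.erase_insert_of_ne hsu
  have hNX : N ⊆ insert s (X.erase u) := hD ▸ Finset.filter_subset _ _
  set K := ∏ v ∈ insert s (X.erase u), vertexPotential α β r X v
  have avoiding_le : walkWeight (rowWeights β r) (X.erase u) s ≤ lightLoss α β ^ N.card * K :=
    (hX.le_prod_insert h r fun hsX => hs (Finset.mem_of_mem_erase hsX)).trans
      (prod_vertexPotential_erase_le_pow h hNX hN)
  have through_le : ∑ v ∈ (insert s X).erase u, rowWeights β r v (some u) *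
      walkWeight (Function.update (rowWeights β r) v (rowWeights β r u)) (X.erase u) s ≤
      N.card * (vertexPotential α β r X u / (lightLoss α β * α) *
        (lightLoss α β ^ N.card * K)) := by
    rw [← nsmul_eq_mul, ← Finset.sum_subset (Finset.filter_subset (fun v => u ∈ (r v).targets) _)]
    · refine Finset.sum_le_card_nsmul _ _ _ fun v hv => ?_
      obtain ⟨a, ne, hr, -⟩ := hN v hv
      have light : rowWeights β r v (some u) = 1 := by
        simp [rowWeights, hr, ExtremalRow.weight, ne.symm]
      rw [light, one_mul]
      exact walkWeight_update_le h hX hs hNX hN hv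
    · intro v hv hvN
      rw [rowWeights, ExtremalRow.weight_of_notMem_targets β fun hvu =>
        hvN (Finset.mem_filter.2 ⟨hv, hvu⟩), zero_mul]
  have := walkWeight_le_erase_add_sum (rowWeights_nonneg h r) hs hu
  linarith

end WalkBound

end

namespace WalkBound

variable (h : IsMetallicMean α β) (ih : ∀ Y ⊂ X, WalkBound α β Y) (hu : u ∈ X) (hw : w ∈ X)
  (huw : u ≠ w) (hN : ∀ v ∈ inNeighbors r X u, (r v).IsFullLightTo ((X.erase w).erase v) u)

include h ih hu

theorem heavy_branch_le
    (hN : ∀ v ∈ inNeighbors r X u, (r v).IsFullLightTo (X.erase v) u) :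
    walkWeight (rowWeights β r) (X.erase u) u ≤ (r u).capacity α β (X.erase u) *
      (lightLoss α β ^ (inNeighbors r X u).card * ∏ v ∈ X.erase u, vertexPotential α β r X v) :=
  (ih _ (Finset.erase_ssubset hu) r u (Finset.notMem_erase u X)).trans
    (mul_le_mul_of_nonneg_left (prod_vertexPotential_erase_le_pow h (Finset.filter_subset _ _) hN)
      (ExtremalRow.capacity_nonneg h _ _))

section

include hw huw hN

theorem light_branch_le :
    walkWeight (rowWeights β r) (X.erase w) w ≤
      lightLoss α β ^ (inNeighbors r X u).card *
        (1 + (inNeighbors r X u).card *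
          (vertexPotential α β r (X.erase w) u / (lightLoss α β * α))) *
        ∏ v ∈ X.erase u, vertexPotential α β r (X.erase w) v := by
  have hu' : u ∈ X.erase w := Finset.mem_erase.2 ⟨huw, hu⟩
  have bound := walkWeight_le_of_light_neighbors (r := r) h
    (ih _ ((Finset.erase_ssubset hu').trans (Finset.erase_ssubset hw)))
    (Finset.notMem_erase w X) hu' (by rwa [Finset.insert_erase hw])
  rwa [Finset.insert_erase hw, ← Finset.erase_insert_of_ne huw.symm, Finset.insert_erase hw]
    at bound

theorem branches_le_of_light_loss (hne : (inNeighbors r X u).Nonempty)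
    (loss : ∏ v ∈ X.erase u, vertexPotential α β r (X.erase w) v ≤
      lightLoss α β * ∏ v ∈ X.erase u, vertexPotential α β r X v) :
    β * walkWeight (rowWeights β r) (X.erase u) u + walkWeight (rowWeights β r) (X.erase w) w ≤
      α * ∏ v ∈ X, vertexPotential α β r X v := by
  obtain ⟨i, hi⟩ := Nat.exists_eq_add_one.2 hne.card_pos
  have heavy_le := heavy_branch_le h ih hu fun v hv =>
    (hN v hv).mono (Finset.erase_subset_erase v (Finset.erase_subset w X))
  have light_le := light_branch_le h ih hu hw huw hN
  rw [hi] at heavy_le light_le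
  push_cast at light_le
  set c := (r u).capacity α β (X.erase u)
  set p := vertexPotential α β r X u
  set ρ := lightLoss α β
  set K := ∏ v ∈ X.erase u, vertexPotential α β r X v
  have hα := h.pos
  have hβ := h.one_le
  have hρ : 0 < ρ := h.lightLoss_pos
  have hp : 0 < p := vertexPotential_pos h r X u
  have hK : 0 < K := prod_vertexPotential_pos h r _ _
  have hp' := vertexPotential_mono h r (Finset.erase_subset w X) u
  calc _ ≤ β * (c * (ρ ^ (i + 1) * K)) +
        ρ ^ (i + 1) * (1 + (i + 1) * (p / (ρ * α))) * (ρ * K) := by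
        refine add_le_add (by gcongr) (light_le.trans ?_)
        gcongr
        exact (prod_vertexPotential_pos h r _ _).le
    _ = (β * (c * ρ ^ (i + 1)) + ρ * (ρ ^ (i + 1) * (1 + (i + 1) * (p / (ρ * α))))) * K := by
        ring
    _ ≤ α * p * K := mul_le_mul_of_nonneg_right (h.light_neighbors_bound hp.le
        (ExtremalRow.potential_le h _ _) (ExtremalRow.mul_capacity_add_one_le h _ _) i) hK.le
    _ = _ := by rw [mul_assoc, Finset.mul_prod_erase _ _ hu]

end

include hw

theorem branches_le_of_sole_light {a : V} {ne : a ≠ w} (hr : r u = .edges a w ne)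
    (huw : u ≠ w) (ha : a ∉ X.erase u) :
    β * walkWeight (rowWeights β r) (X.erase u) u + walkWeight (rowWeights β r) (X.erase w) w ≤
      α * ∏ v ∈ X, vertexPotential α β r X v := by
  have hw' : w ∈ X.erase u := Finset.mem_erase.2 ⟨huw.symm, hw⟩
  set K := ∏ v ∈ X.erase u, vertexPotential α β r X v with hK
  have heavy_le : walkWeight (rowWeights β r) (X.erase u) u ≤ K := by
    have bound := ih _ (Finset.erase_ssubset hu) r u (Finset.notMem_erase u X)
    rw [hr, ExtremalRow.capacity, if_neg ha, if_pos hw', one_mul] at bound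
    exact bound.trans (prod_vertexPotential_mono h r (Finset.erase_subset u X) _)
  have light_le : walkWeight (rowWeights β r) (X.erase w) w ≤ K := by
    have bound := (ih _ (Finset.erase_ssubset hw)).le_prod_insert h r (Finset.notMem_erase w X)
    have dead : vertexPotential α β r (X.erase w) u = 1 := by
      rw [vertexPotential, Finset.erase_right_comm, hr, ExtremalRow.potential,
        if_neg fun ha' => ha (Finset.mem_of_mem_erase ha'), if_neg (Finset.notMem_erase w _)]
    rw [Finset.insert_erase hw, ← Finset.mul_prod_erase _ _ hu, dead, one_mul] at bound
    exact bound.trans (prod_vertexPotential_mono h r (Finset.erase_subset w X) _)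
  have potential_eq : vertexPotential α β r X u = 2 * β / α := by
    rw [vertexPotential, hr, ExtremalRow.potential, if_neg ha, if_pos hw']
  have hβ := h.one_le
  have hα := h.pos
  have hK0 : 0 < K := prod_vertexPotential_pos h r _ _
  calc _ ≤ β * K + K := by gcongr
    _ ≤ 2 * β * K := by nlinarith
    _ = _ := by rw [← Finset.mul_prod_erase _ _ hu, potential_eq, ← hK]; field_simp

theorem heavy_branch_le_of_sole_in_neighbor {a : V} {ne : a ≠ w} (hr : r u = .edges a w ne)
    (huw : u ≠ w) (ha : a ∈ X.erase u) (hNw : inNeighbors r X w ⊆ {u})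
    (hN : ∀ v ∈ inNeighbors r X u, (r v).IsFullLightTo (X.erase v) u) :
    walkWeight (rowWeights β r) (X.erase u) u ≤
      (β + (r w).capacity α β (X.erase w)) *
        (lightLoss α β ^ ((inNeighbors r X u).erase w).card *
          ∏ v ∈ (X.erase u).erase w, vertexPotential α β r X v) := by
  have hw' : w ∈ X.erase u := Finset.mem_erase.2 ⟨huw.symm, hw⟩
  have isolated : inNeighbors r (X.erase u) w = ∅ := by
    refine Finset.eq_empty_of_forall_notMem fun v hv => ?_
    obtain ⟨hvX, hvw⟩ := mem_inNeighbors.1 hv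
    rw [Finset.erase_right_comm] at hvX
    have : v ∈ inNeighbors r X w := mem_inNeighbors.2 ⟨Finset.mem_of_mem_erase hvX, hvw⟩
    exact Finset.ne_of_mem_erase hvX (Finset.mem_singleton.1 (hNw this))
  have bound := branches_le_mul_of_light_isolated h
    (fun Y hY => ih Y (hY.trans (Finset.erase_ssubset hu))) ha hw' ne isolated
  rw [walkWeight_of_edges hr, if_pos ha, if_pos hw']
  have loss := prod_vertexPotential_erase_le_pow h (T := (X.erase u).erase w)
    (Finset.erase_subset_erase w (Finset.filter_subset (fun v => u ∈ (r v).targets) (X.erase u)))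
    fun v hv => hN v (Finset.mem_of_mem_erase hv)
  refine bound.trans (mul_le_mul (add_le_add_right ?_ β) (le_trans ?_ loss)
    (prod_vertexPotential_pos h r _ _).le ?_)
  · exact ExtremalRow.capacity_mono h (Finset.erase_subset_erase w (Finset.erase_subset u X)) _
  · exact prod_vertexPotential_mono h r (Finset.erase_subset w _) _
  · exact add_nonneg (zero_le_one.trans h.one_le) (ExtremalRow.capacity_nonneg h _ _)

include huw hN

theorem light_branch_le_of_full (full : (r u).IsFullLightTo (X.erase u) w) :
    walkWeight (rowWeights β r) (X.erase w) w ≤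
      lightLoss α β ^ (inNeighbors r X u).card * (1 + (inNeighbors r X u).card) *
        ∏ v ∈ X.erase u, vertexPotential α β r X v := by
  have ratio : vertexPotential α β r (X.erase w) u / (lightLoss α β * α) = 1 := by
    rw [vertexPotential_erase_of_isFullLightTo h full, vertexPotential_of_isFullLightTo α β full]
    exact div_self (mul_pos h.lightLoss_pos h.pos).ne'
  have bound := light_branch_le h ih hu hw huw hN
  rw [ratio, mul_one] at bound
  have := h.lightLoss_pos
  exact bound.trans (mul_le_mul_of_nonneg_left
    (prod_vertexPotential_mono h r (Finset.erase_subset w X) _) (by positivity))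

theorem branches_le_of_full_sole_in_neighbor (hβ : 2 ≤ β) {a : V} {ne : a ≠ w}
    (hr : r u = .edges a w ne) (ha : a ∈ X.erase u) (hNw : inNeighbors r X w ⊆ {u})
    (hne : (inNeighbors r X u).Nonempty) :
    β * walkWeight (rowWeights β r) (X.erase u) u + walkWeight (rowWeights β r) (X.erase w) w ≤
      α * ∏ v ∈ X, vertexPotential α β r X v := by
  have hw' : w ∈ X.erase u := Finset.mem_erase.2 ⟨huw.symm, hw⟩
  obtain ⟨i, hi⟩ := Nat.exists_eq_add_one.2 hne.card_pos
  have hN' : ∀ v ∈ inNeighbors r X u, (r v).IsFullLightTo (X.erase v) u := fun v hv =>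
    (hN v hv).mono (Finset.erase_subset_erase v (Finset.erase_subset w X))
  have heavy_le := heavy_branch_le_of_sole_in_neighbor h ih hu hw hr huw ha hNw hN'
  have full : (r u).IsFullLightTo (X.erase u) w := ⟨a, ne, hr, ha, hw'⟩
  have light_le := light_branch_le_of_full h ih hu hw huw hN full
  rw [hi, ← Finset.mul_prod_erase _ _ hw'] at light_le
  push_cast at light_le
  rw [← Finset.mul_prod_erase _ _ hu, vertexPotential_of_isFullLightTo α β full,
    ← Finset.mul_prod_erase _ _ hw']
  set ρ := lightLoss α β
  set p := vertexPotential α β r X w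
  set K := ∏ v ∈ (X.erase u).erase w, vertexPotential α β r X v
  have hβ0 : 0 < β := by linarith
  have hρ : 0 < ρ := h.lightLoss_pos
  have hK : 0 < K := prod_vertexPotential_pos h r _ _
  have main : β * ((β + (r w).capacity α β (X.erase w)) *
      ρ ^ ((inNeighbors r X u).erase w).card) + ρ ^ (i + 1) * (1 + (i + 1)) * p ≤ α ^ 2 * p := by
    by_cases hwu : w ∈ inNeighbors r X u
    · have hp : p = α := vertexPotential_of_isFullLightTo α β (hN' w hwu)
      rw [Finset.card_erase_of_mem hwu, hi, Nat.add_sub_cancel, hp]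
      refine le_trans ?_ (h.mutual_light_neighbor_bound hβ i)
      gcongr
      exact ExtremalRow.capacity_le h _ _
    · rw [Finset.erase_eq_of_notMem hwu, hi]
      exact h.shared_light_neighbor_bound (vertexPotential_pos h r X w).le
        (ExtremalRow.mul_add_capacity_add_potential_le h _ _ hβ) i
  linarith [mul_le_mul_of_nonneg_left heavy_le hβ0.le, mul_le_mul_of_nonneg_right main hK.le]

end WalkBound

namespace WalkBound

variable (h : IsMetallicMean α β) (ih : ∀ Y ⊂ X, WalkBound α β Y) (hu : u ∈ X) (hw : w ∈ X)

include h ih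

section

include hu hw

theorem branches_le_of_losses {x y : V} (hx : x ∈ inNeighbors r X u) (hy : y ∈ inNeighbors r X w)
    {c d : ℝ} (hc : vertexPotential α β r (X.erase u) x ≤ c * vertexPotential α β r X x)
    (hd : vertexPotential α β r (X.erase w) y ≤ d * vertexPotential α β r X y)
    (hcd : β * c + d ≤ α) :
    β * walkWeight (rowWeights β r) (X.erase u) u + walkWeight (rowWeights β r) (X.erase w) w ≤
      α * ∏ v ∈ X, vertexPotential α β r X v := by
  have heavy_le := (ih _ (Finset.erase_ssubset hu)).le_mul_prod_of_loss h hu hx hc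
  have light_le := (ih _ (Finset.erase_ssubset hw)).le_mul_prod_of_loss h hw hy hd
  have hβ := zero_le_one.trans h.one_le
  linarith [mul_le_mul_of_nonneg_left heavy_le hβ,
    mul_le_mul_of_nonneg_right hcd (prod_vertexPotential_pos h r X X).le]

variable (huw : u ≠ w)

include huw

theorem branches_le_of_full_light_neighbors (hβ : 2 ≤ β) (hNu : (inNeighbors r X u).Nonempty)
    (hNw : (inNeighbors r X w).Nonempty)
    (hNu_full : ∀ v ∈ inNeighbors r X u, (r v).IsFullLightTo ((X.erase w).erase v) u)
    (hNw_light : ∀ v ∈ inNeighbors r X w, ∀ b ne, r v ≠ .edges w b ne) :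
    β * walkWeight (rowWeights β r) (X.erase u) u + walkWeight (rowWeights β r) (X.erase w) w ≤
      α * ∏ v ∈ X, vertexPotential α β r X v := by
  by_cases sole : inNeighbors r X w ⊆ {u}
  · have huN : u ∈ inNeighbors r X w := by
      obtain ⟨v, hv⟩ := hNw
      exact Finset.mem_singleton.1 (sole hv) ▸ hv
    obtain ⟨b, ne, hr⟩ | ⟨a, ne, hr⟩ :=
      ExtremalRow.exists_eq_edges_of_mem_targets (mem_inNeighbors.1 huN).2
    · exact absurd hr (hNw_light u huN b ne)
    by_cases ha : a ∈ X.erase u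
    · exact branches_le_of_full_sole_in_neighbor h ih hu hw huw hNu_full hβ hr ha sole hNu
    · exact branches_le_of_sole_light h ih hu hw hr huw ha
  · obtain ⟨x, hx, hxu⟩ := Finset.not_subset.1 sole
    have hxX : x ∈ X.erase u := Finset.mem_erase.2
      ⟨Finset.notMem_singleton.1 hxu, Finset.mem_of_mem_erase (mem_inNeighbors.1 hx).1⟩
    have loss := prod_vertexPotential_le_of_loss h (r := r) (Finset.erase_subset w X)
      (Finset.singleton_subset_iff.2 hxX) (c := fun _ => lightLoss α β) (by
        simpa only [Finset.mem_singleton, forall_eq] using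
          vertexPotential_erase_le_of_mem_inNeighbors h le_rfl (h.div_le_lightLoss hβ) hw hx)
    rw [Finset.prod_singleton] at loss
    exact branches_le_of_light_loss h ih hu hw huw hNu_full hNu loss

theorem branches_le_of_two_le (hβ : 2 ≤ β) (hNu : (inNeighbors r X u).Nonempty)
    (hNw : (inNeighbors r X w).Nonempty) :
    β * walkWeight (rowWeights β r) (X.erase u) u + walkWeight (rowWeights β r) (X.erase w) w ≤
      α * ∏ v ∈ X, vertexPotential α β r X v := by
  have light_loss {v z : V} (hz : z ∈ X) (hv : v ∈ inNeighbors r X z) :=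
    vertexPotential_erase_le_of_mem_inNeighbors h le_rfl (h.div_le_lightLoss hβ) hz hv
  obtain ⟨x, hx⟩ := id hNu
  obtain ⟨y, hy⟩ := id hNw
  by_cases heavy_u : ∃ v ∈ inNeighbors r X u, ∃ b ne, r v = .edges u b ne
  · obtain ⟨v, hv, b, ne, hr⟩ := heavy_u
    exact branches_le_of_losses h ih hu hw hv hy (vertexPotential_erase_le_of_heavy h hβ hu hv hr)
      (light_loss hw hy) h.mul_heavyLoss_add_lightLoss_le
  by_cases heavy_w : ∃ v ∈ inNeighbors r X w, ∃ b ne, r v = .edges w b ne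
  · obtain ⟨v, hv, b, ne, hr⟩ := heavy_w
    exact branches_le_of_losses h ih hu hw hx hv (light_loss hu hx)
      (vertexPotential_erase_le_of_heavy h hβ hw hv hr) h.mul_lightLoss_add_heavyLoss_le
  push Not at heavy_u heavy_w
  by_cases sole_u : ∃ v ∈ inNeighbors r X u, ∃ a ne, r v = .edges a u ne ∧ a ∉ X.erase v
  · obtain ⟨v, hv, a, ne, hr, ha⟩ := sole_u
    refine branches_le_of_losses h ih hu hw hv hy (c := α / (2 * β)) (le_of_eq ?_)
      (light_loss hw hy) ?_
    · rw [vertexPotential, vertexPotential, Finset.erase_right_comm, hr,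
        ExtremalRow.potential_erase_sole_light h ha (mem_erase_of_mem_inNeighbors hu hv)]
    · have : β * (α / (2 * β)) = α / 2 := by field_simp
      linarith [h.lightLoss_le_half]
  push Not at sole_u
  refine branches_le_of_full_light_neighbors h ih hu hw huw hβ hNu hNw (fun v hv => ?_) heavy_w
  obtain ⟨b, ne, hr⟩ | ⟨a, ne, hr⟩ :=
    ExtremalRow.exists_eq_edges_of_mem_targets (mem_inNeighbors.1 hv).2
  · exact absurd hr (heavy_u v hv b ne)
  have ha : a ∈ X.erase v := sole_u v hv a ne hr
  have haw : a ≠ w := by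
    rintro rfl
    refine heavy_w v (mem_inNeighbors.2 ⟨Finset.mem_erase.2 ⟨?_, ?_⟩, ?_⟩) u ne hr
    · exact (Finset.ne_of_mem_erase ha).symm
    · exact Finset.mem_of_mem_erase (mem_inNeighbors.1 hv).1
    · simp [hr, ExtremalRow.targets]
  rw [Finset.erase_right_comm]
  exact ⟨a, ne, hr, Finset.mem_erase.2 ⟨haw, ha⟩,
    Finset.mem_erase.2 ⟨huw, mem_erase_of_mem_inNeighbors hu hv⟩⟩

theorem branches_le (hβ : β = 1 ∨ 2 ≤ β) :
    β * walkWeight (rowWeights β r) (X.erase u) u + walkWeight (rowWeights β r) (X.erase w) w ≤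
      α * ∏ v ∈ X, vertexPotential α β r X v := by
  obtain hNu | hNu := (inNeighbors r X u).eq_empty_or_nonempty
  · exact branches_le_of_heavy_isolated h ih hu hw huw hNu
  obtain hNw | hNw := (inNeighbors r X w).eq_empty_or_nonempty
  · exact branches_le_of_light_isolated h ih hu hw huw hNw
  obtain rfl | hβ := hβ
  · obtain ⟨x, hx⟩ := hNu
    obtain ⟨y, hy⟩ := hNw
    have half_loss {v z : V} (hz : z ∈ X) (hv : v ∈ inNeighbors r X z) :=
      vertexPotential_erase_le_of_mem_inNeighbors h h.lightLoss_le_half (by rw [mul_one]) hz hv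
    exact branches_le_of_losses h ih hu hw hx hy (half_loss hu hx) (half_loss hw hy) (by linarith)
  · exact branches_le_of_two_le h ih hu hw huw hβ hNu hNw

end

end WalkBound

theorem walkBound (h : IsMetallicMean α β) (hβ : β = 1 ∨ 2 ≤ β) (X : Finset V) :
    WalkBound α β X := by
  induction X using Finset.strongInduction with
  | H X ih =>
    intro r s _
    have branch_le {u : V} (hu : u ∈ X) := (ih _ (Finset.erase_ssubset hu)).le_prod h r hu
    have hβ0 : 0 ≤ β := zero_le_one.trans h.one_le
    cases hr : r s with
    | exit =>
      have : walkWeight (rowWeights β r) X s = 1 := by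
        rw [walkWeight_eq]
        simp [rowWeights, hr, ExtremalRow.weight]
      rw [this, ExtremalRow.capacity, one_mul]
      exact Finset.one_le_prod fun v _ => ExtremalRow.one_le_potential h _ _
    | edges u w huw =>
      rw [walkWeight_of_edges hr, ExtremalRow.capacity]
      by_cases hu : u ∈ X <;> by_cases hw : w ∈ X <;>
        simp only [hu, hw, ↓reduceIte, add_zero, zero_add, one_mul, zero_mul, le_refl]
      · exact WalkBound.branches_le h ih hu hw huw hβ
      · exact mul_le_mul_of_nonneg_left (branch_le hu) hβ0
      · exact branch_le hw

theorem walkWeight_rowWeights_le_two_mul_pow [Fintype V] (h : IsMetallicMean α β)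
    (hβ : β = 1 ∨ 2 ≤ β) {r : V → ExtremalRow V} {t : V} (ht : r t = .exit) (s : V) :
    walkWeight (rowWeights β r) (Finset.univ.erase s) s ≤ 2 * α ^ (Fintype.card V - 1) := by
  refine ((walkBound h hβ _).le_prod h r (Finset.mem_univ s)).trans ?_
  rw [← Finset.mul_prod_erase _ _ (Finset.mem_univ t)]
  have others_le : ∏ v ∈ Finset.univ.erase t, vertexPotential α β r Finset.univ v ≤
      α ^ (Fintype.card V - 1) := by
    rw [← Finset.card_univ, ← Finset.card_erase_of_mem (Finset.mem_univ t), ← Finset.prod_const]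
    exact Finset.prod_le_prod (fun v _ => (vertexPotential_pos h r _ v).le)
      fun v _ => ExtremalRow.potential_le h _ _
  have exit_le : vertexPotential α β r Finset.univ t ≤ 2 := by
    rw [vertexPotential, ht, ExtremalRow.potential, div_le_iff₀ h.pos]
    linarith [h.lt]
  exact mul_le_mul exit_le others_le (prod_vertexPotential_pos h r _ _).le zero_le_two

end WalkBounds

section Domination

variable {V : Type*} [DecidableEq V] [Fintype V] {α β : ℝ}

theorem exists_walkWeight_le_rowWeights (hβ : 0 ≤ β) {W : V → Option V → ℝ}
    (hW : ∀ v o, 0 ≤ W v o) {X : Finset V} {s : V} (hs : s ∉ X)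
    {IsAllowed : V → ExtremalRow V → Prop}
    (hdom : ∀ v (c : Option V → ℝ), (∀ o, 0 ≤ c o) →
      ∃ R, IsAllowed v R ∧ ∑ o, W v o * c o ≤ ∑ o, R.weight β o * c o) :
    ∃ r : V → ExtremalRow V, (∀ v, IsAllowed v (r v)) ∧
      walkWeight W X s ≤ walkWeight (rowWeights β r) X s := by
  suffices replace : ∀ F : Finset V, ∃ r : V → ExtremalRow V, (∀ v, IsAllowed v (r v)) ∧
      walkWeight W X s ≤ walkWeight (F.piecewise (rowWeights β r) W) X s by
    simpa only [Finset.piecewise_univ] using replace Finset.univ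
  intro F
  induction F using Finset.induction_on with
  | empty =>
    choose r hr _ using fun v => hdom v 0 fun _ => le_rfl
    exact ⟨r, hr, by rw [Finset.piecewise_empty]⟩
  | insert v F hv ih =>
    obtain ⟨r, hr, hle⟩ := ih
    set W' := F.piecewise (rowWeights β r) W
    have hW' : 0 ≤ W' := F.le_piecewise_of_le_of_le (h := 0)
      (fun y o => (r y).weight_nonneg hβ o) hW
    obtain ⟨a, c, hc, linear⟩ := exists_walkWeight_update_eq hW' hs v
    obtain ⟨R, hR, hRle⟩ := hdom v c hc
    refine ⟨Function.update r v R, (Function.forall_update_iff r _).2 ⟨hR, fun y _ => hr y⟩,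
      hle.trans ?_⟩
    have old_eq : Function.update W' v (W v) = W' := by
      rw [Function.update_eq_self_iff]
      exact (Finset.piecewise_eq_of_notMem F _ _ hv).symm
    have new_eq : (insert v F).piecewise (rowWeights β (Function.update r v R)) W =
        Function.update W' v (R.weight β) := by
      rw [Finset.piecewise_insert, rowWeights_update, Function.update_self]
      congr 1
      exact F.piecewise_congr (fun y hy => Function.update_of_ne (ne_of_mem_of_not_mem hy hv) _ _)
        fun _ _ => rfl
    rw [new_eq, ← old_eq, Function.update_idem, linear, linear]
    exact add_le_add_right hRle a

theorem exists_sum_mul_le_sum_weight_mul [Nontrivial V] {f : Option V → ℝ} (hf : ∀ o, 0 ≤ f o)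
    (f_none : f none = 0) (f_le : ∀ u, f (some u) ≤ β) (sum_le : ∑ u, f (some u) ≤ β + 1)
    {c : Option V → ℝ} (hc : ∀ o, 0 ≤ c o) :
    ∃ R : ExtremalRow V, ∑ o, f o * c o ≤ ∑ o, R.weight β o * c o := by
  obtain ⟨u, -, hu⟩ := Finset.exists_max_image Finset.univ (fun v => c (some v))
    Finset.univ_nonempty
  obtain ⟨z, hz⟩ := exists_ne u
  obtain ⟨w, hw, hw_max⟩ := Finset.exists_max_image (Finset.univ.erase u) (fun v => c (some v))
    ⟨z, Finset.mem_erase.2 ⟨hz, Finset.mem_univ z⟩⟩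
  have huw : u ≠ w := (Finset.ne_of_mem_erase hw).symm
  refine ⟨.edges u w huw, ?_⟩
  have extremal_eq : ∑ o, (ExtremalRow.edges u w huw).weight β o * c o =
      β * c (some u) + c (some w) := by
    simp [ExtremalRow.weight, add_mul, Finset.sum_add_distrib, ite_mul]
  have rest_le : ∑ y ∈ Finset.univ.erase u, f (some y) * c (some y) ≤
      (∑ y ∈ Finset.univ.erase u, f (some y)) * c (some w) := by
    rw [Finset.sum_mul]
    gcongr with y hy
    · exact hf _
    · exact hw_max y hy
  rw [← Finset.add_sum_erase _ _ (Finset.mem_univ u)] at sum_le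
  rw [extremal_eq, Fintype.sum_option, f_none, zero_mul, zero_add,
    ← Finset.add_sum_erase _ _ (Finset.mem_univ u)]
  nlinarith [mul_nonneg (sub_nonneg.2 (f_le u)) (sub_nonneg.2 (hu w (Finset.mem_univ w))),
    mul_le_mul_of_nonneg_right sum_le (hc (some w))]

theorem walkWeight_le_two_mul_pow [Nontrivial V] (h : IsMetallicMean α β) (hβ : β = 1 ∨ 2 ≤ β)
    {W : V → Option V → ℝ} (hW : ∀ v o, 0 ≤ W v o) {t : V}
    (hWt : W t = Pi.single none 1) (none_eq : ∀ v ≠ t, W v none = 0)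
    (some_le : ∀ v ≠ t, ∀ u, W v (some u) ≤ β) (sum_le : ∀ v ≠ t, ∑ u, W v (some u) ≤ β + 1)
    (s : V) : walkWeight W (Finset.univ.erase s) s ≤ 2 * α ^ (Fintype.card V - 1) := by
  obtain ⟨r, hr, hle⟩ := exists_walkWeight_le_rowWeights (zero_le_one.trans h.one_le) hW
    (Finset.notMem_erase s Finset.univ) (IsAllowed := fun v R => v = t → R = .exit)
    fun v c hc => by
      obtain rfl | hv := eq_or_ne v t
      · exact ⟨.exit, fun _ => rfl, by rw [hWt, ExtremalRow.weight_exit]⟩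
      · obtain ⟨R, hR⟩ := exists_sum_mul_le_sum_weight_mul (hW v) (none_eq v hv) (some_le v hv)
          (sum_le v hv) hc
        exact ⟨R, fun e => absurd e hv, hR⟩
  exact hle.trans (walkWeight_rowWeights_le_two_mul_pow h hβ (hr t rfl) s)

end Domination

section Lassos

variable {S A : Type*} [DecidableEq S] (next : S → A → S) (Act : S → Finset A)

/-- The number of ways to walk from `s` by means of the available actions `Act`, visiting states of
`X` at most once each, until an action leads out of `X`. If `X` consists of the states which are not
yet visited, then these are the lassos which extend the walk made so far. -/
def lassoCount (X : Finset S) (s : S) : ℕ :=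
  ∑ a ∈ Act s, if _ : next s a ∈ X then lassoCount (X.erase (next s a)) (next s a) else 1
termination_by X.card
decreasing_by exact Finset.card_erase_lt_of_mem ‹next s a ∈ X›

theorem lassoCount_eq (X : Finset S) (s : S) :
    lassoCount next Act X s = ∑ a ∈ Act s,
      if next s a ∈ X then lassoCount next Act (X.erase (next s a)) (next s a) else 1 := by
  rw [lassoCount]
  simp only [dite_eq_ite]

/-- The value of `val` at a policy depends only on the actions at the states of any set which
contains `s₀` and which the policy does not leave. -/
def DependsOnlyOnOrbit {B : Type*} (s₀ : S) (val : (S → A) → B) : Prop :=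
  ∀ (π π' : S → A) (K : Set S), s₀ ∈ K → (∀ v ∈ K, next v (π v) ∈ K) → (∀ v ∈ K, π v = π' v) →
    val π = val π'

variable {next Act}

theorem card_image_le_sum_card_image_filter {ι κ β : Type*} [DecidableEq κ] [DecidableEq β]
    {P : Finset ι} {T : Finset κ} {g : ι → κ} (hg : ∀ i ∈ P, g i ∈ T) (f : ι → β) :
    (P.image f).card ≤ ∑ a ∈ T, (({i ∈ P | g i = a} : Finset ι).image f).card := by
  classical
  calc (P.image f).card = ((T.biUnion fun a => {i ∈ P | g i = a}).image f).card := by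
        rw [Finset.biUnion_filter_eq_of_maps_to hg]
    _ ≤ _ := by
      rw [Finset.biUnion_image]
      exact Finset.card_biUnion_le

theorem card_image_le_lassoCount {B : Type*} [DecidableEq B] {s₀ : S}
    {val : (S → A) → B} (hval : DependsOnlyOnOrbit next s₀ val) (X : Finset S) {s : S}
    (hs : s ∉ X) (hs₀ : s₀ ∉ X) (P : Finset (S → A))
    (hP : ∀ π ∈ P, ∀ v ∈ insert s X, π v ∈ Act v)
    (agree : ∀ π ∈ P, ∀ π' ∈ P, ∀ v ∉ insert s X, π v = π' v)
    (closed : ∀ π ∈ P, ∀ v ∉ insert s X, next v (π v) ∉ X) :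
    (P.image val).card ≤ lassoCount next Act X s := by
  induction X using Finset.strongInduction generalizing s P with
  | H X ih =>
    classical
    have agree_at {a : A} : ∀ π ∈ ({π ∈ P | π s = a} : Finset _),
        ∀ π' ∈ ({π ∈ P | π s = a} : Finset _), ∀ v ∉ X, π v = π' v := by
      intro π hπ π' hπ' v hv
      rw [Finset.mem_filter] at hπ hπ'
      obtain rfl | hvs := eq_or_ne v s
      · rw [hπ.2, hπ'.2]
      · exact agree π hπ.1 π' hπ'.1 v (by simp [hvs, hv])
    have closed_at {a : A} {Y : Finset S} (hYX : Y ⊆ X) (ha : next s a ∉ Y) :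
        ∀ π ∈ ({π ∈ P | π s = a} : Finset _), ∀ v ∉ X, next v (π v) ∉ Y := by
      intro π hπ v hv
      rw [Finset.mem_filter] at hπ
      obtain rfl | hvs := eq_or_ne v s
      · rwa [hπ.2]
      · exact fun hY => closed π hπ.1 v (by simp [hvs, hv]) (hYX hY)
    rw [lassoCount_eq]
    refine (card_image_le_sum_card_image_filter (fun π hπ => hP π hπ s (Finset.mem_insert_self s X))
      val).trans (Finset.sum_le_sum fun a _ => ?_)
    split_ifs with ha
    · refine ih _ (Finset.erase_ssubset ha) (Finset.notMem_erase _ _)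
        (fun hX => hs₀ (Finset.mem_of_mem_erase hX)) _ ?_ ?_ ?_
      · rw [Finset.insert_erase ha]
        exact fun π hπ v hv => hP π (Finset.mem_filter.1 hπ).1 v (Finset.mem_insert_of_mem hv)
      · simpa only [Finset.insert_erase ha] using agree_at
      · simpa only [Finset.insert_erase ha] using
          closed_at (Finset.erase_subset _ X) (Finset.notMem_erase _ _)
    · refine Finset.card_le_one.2 fun x hx y hy => ?_
      obtain ⟨π, hπ, rfl⟩ := Finset.mem_image.1 hx
      obtain ⟨π', hπ', rfl⟩ := Finset.mem_image.1 hy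
      exact hval π π' {v | v ∉ X} hs₀ (closed_at subset_rfl ha π hπ) (agree_at π hπ π' hπ')

variable (next Act)

/-- The row of edge weights at `v` which counts the available actions leading to each state. -/
def actionRow (v : S) (o : Option S) : ℝ :=
  o.elim 0 fun y => ({a ∈ Act v | next v a = y} : Finset A).card

theorem sum_actionRow_mul (v : S) (X : Finset S) (c : S → ℝ) :
    ∑ y ∈ X, actionRow next Act v (some y) * c y =
      ∑ a ∈ Act v, if next v a ∈ X then c (next v a) else 0 := by
  have expand : ∀ y ∈ X, actionRow next Act v (some y) * c y =
      ∑ a ∈ Act v, if next v a = y then c y else 0 := by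
    intro y _
    rw [actionRow, Option.elim_some, ← Finset.sum_filter, Finset.sum_const, nsmul_eq_mul]
  rw [Finset.sum_congr rfl expand, Finset.sum_comm]
  simp only [Finset.sum_ite_eq]

/-- The edge weights for which `walkWeight` counts the walks that end at `t`. -/
def actionWeights (t : S) : S → Option S → ℝ :=
  Function.update (actionRow next Act) t (Pi.single none 1)

theorem actionWeights_self (t : S) : actionWeights next Act t t = Pi.single none 1 :=
  Function.update_self ..

theorem actionWeights_of_ne {t v : S} (hv : v ≠ t) :
    actionWeights next Act t v = actionRow next Act v :=
  Function.update_of_ne hv ..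

theorem actionWeights_nonneg (t v : S) (o : Option S) : 0 ≤ actionWeights next Act t v o := by
  obtain rfl | hv := eq_or_ne v t
  · rw [actionWeights_self, Pi.single_apply]
    positivity
  · rw [actionWeights_of_ne next Act hv]
    cases o with
    | none => exact le_rfl
    | some y => exact Nat.cast_nonneg _

theorem walkWeight_actionWeights_self {X : Finset S} (s : S) :
    walkWeight (actionWeights next Act s) X s = 1 := by
  rw [walkWeight_eq, actionWeights_self]
  simp

theorem walkWeight_actionWeights_of_ne {X : Finset S} {s t : S} (hst : s ≠ t) :
    walkWeight (actionWeights next Act t) X s = ∑ a ∈ Act s, if next s a ∈ X then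
      walkWeight (actionWeights next Act t) (X.erase (next s a)) (next s a) else 0 := by
  rw [walkWeight_eq, actionWeights_of_ne next Act hst, ← sum_actionRow_mul next Act s X
    fun y => walkWeight (actionWeights next Act t) (X.erase y) y]
  exact zero_add _

theorem lassoCount_le_mul_sum_walkWeight {k : ℕ} (hk : ∀ v, (Act v).card ≤ k) (X : Finset S)
    {s : S} (hs : s ∉ X) : (lassoCount next Act X s : ℝ) ≤
      k * ∑ t ∈ insert s X, walkWeight (actionWeights next Act t) X s := by
  induction X using Finset.strongInduction generalizing s with
  | H X ih =>
    have branch_le : ∀ a ∈ Act s, ((if next s a ∈ X then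
        lassoCount next Act (X.erase (next s a)) (next s a) else 1 : ℕ) : ℝ) ≤
        1 + k * ∑ t ∈ X, if next s a ∈ X then
          walkWeight (actionWeights next Act t) (X.erase (next s a)) (next s a) else 0 := by
      intro a _
      split_ifs with ha
      · have := ih _ (Finset.erase_ssubset ha) (Finset.notMem_erase _ _)
        rw [Finset.insert_erase ha] at this
        linarith
      · simp
    have targets_eq : ∀ t ∈ X, walkWeight (actionWeights next Act t) X s =
        ∑ a ∈ Act s, if next s a ∈ X then
          walkWeight (actionWeights next Act t) (X.erase (next s a)) (next s a) else 0 :=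
      fun t ht => walkWeight_actionWeights_of_ne next Act (ne_of_mem_of_not_mem ht hs).symm
    rw [lassoCount_eq, Nat.cast_sum, Finset.sum_insert hs, walkWeight_actionWeights_self,
      Finset.sum_congr rfl targets_eq, Finset.sum_comm, mul_add, mul_one, Finset.mul_sum]
    refine (Finset.sum_le_sum branch_le).trans ?_
    rw [Finset.sum_add_distrib, Finset.sum_const, nsmul_one]
    gcongr
    exact hk s

theorem lassoCount_le [Fintype S] [Nontrivial S] {α : ℝ} {k : ℕ}
    (h : IsMetallicMean α ((k : ℝ) - 1)) (hcard : ∀ v, (Act v).card ≤ k)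
    (hnext : ∀ v y, ({a ∈ Act v | next v a = y} : Finset A).card < k) (s : S) :
    (lassoCount next Act (Finset.univ.erase s) s : ℝ) ≤
      k * (Fintype.card S * (2 * α ^ (Fintype.card S - 1))) := by
  have two_cases : (k : ℝ) - 1 = 1 ∨ 2 ≤ (k : ℝ) - 1 := by
    obtain rfl | hk := h.two_le_natCast.eq_or_lt
    · norm_num
    · have : ((3 : ℕ) : ℝ) ≤ k := Nat.cast_le.2 hk
      right
      push_cast at this
      linarith
  refine (lassoCount_le_mul_sum_walkWeight next Act hcard _ (Finset.notMem_erase s _)).trans ?_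
  gcongr
  rw [← nsmul_eq_mul, Finset.insert_erase (Finset.mem_univ s), ← Finset.card_univ]
  refine Finset.sum_le_card_nsmul _ _ _ fun t _ => walkWeight_le_two_mul_pow h two_cases
    (actionWeights_nonneg next Act t) (actionWeights_self next Act t) (fun v hv => ?_)
    (fun v hv u => ?_) (fun v hv => ?_) s
  · rw [actionWeights_of_ne next Act hv, actionRow, Option.elim_none]
  · rw [actionWeights_of_ne next Act hv, actionRow, Option.elim_some, le_sub_iff_add_le]
    exact_mod_cast hnext v u
  · have row_sum := sum_actionRow_mul next Act v Finset.univ 1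
    simp only [Pi.one_apply, mul_one, Finset.mem_univ, ↓reduceIte, Finset.sum_const, nsmul_one]
      at row_sum
    rw [actionWeights_of_ne next Act hv, row_sum, sub_add_cancel]
    exact_mod_cast hcard v

variable {next Act}

theorem card_image_le_of_dependsOnlyOnOrbit [Fintype S] [Nontrivial S] {B : Type*}
    [DecidableEq B] {α : ℝ} {k : ℕ} (h : IsMetallicMean α ((k : ℝ) - 1))
    (hcard : ∀ v, (Act v).card ≤ k)
    (hnext : ∀ v y, ({a ∈ Act v | next v a = y} : Finset A).card < k) {s₀ : S}
    {val : (S → A) → B} (hval : DependsOnlyOnOrbit next s₀ val) (P : Finset (S → A))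
    (hP : ∀ π ∈ P, ∀ v, π v ∈ Act v) :
    ((P.image val).card : ℝ) ≤ k * (Fintype.card S * (2 * α ^ (Fintype.card S - 1))) := by
  refine le_trans (Nat.cast_le.2 ?_) (lassoCount_le next Act h hcard hnext s₀)
  exact card_image_le_lassoCount hval _ (Finset.notMem_erase _ _) (Finset.notMem_erase _ _) P
    (fun π hπ v _ => hP π hπ v) (by simp) (by simp)

end Lassos

namespace MDP

variable {S A : Type*} [Fintype S] (M : MDP S A)

theorem stateProb_succ' (π : S → A) (s : S) (t : ℕ) (s' : S) :
    M.stateProb π s (t + 1) s' = ∑ u, M.T s (π s) u * M.stateProb π u t s' := by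
  induction t generalizing s' with
  | zero => classical simp [stateProb, eq_comm]
  | succ t ih =>
    rw [stateProb]
    simp_rw [ih, stateProb, Finset.sum_mul, Finset.mul_sum]
    rw [Finset.sum_comm]
    simp_rw [mul_assoc]

theorem expectedReward_zero (π : S → A) (s : S) :
    M.expectedReward π s 0 = M.R s (π s) := by
  classical simp [expectedReward, stateProb]

theorem expectedReward_succ (π : S → A) (s : S) (t : ℕ) :
    M.expectedReward π s (t + 1) = ∑ u, M.T s (π s) u * M.expectedReward π u t := by
  simp_rw [expectedReward, stateProb_succ', Finset.sum_mul, Finset.mul_sum]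
  rw [Finset.sum_comm]
  simp_rw [mul_assoc]

theorem value_eq_actionValue (π : S → A) (s : S) : M.value π s = M.actionValue π s (π s) := by
  have term_succ : ∀ t : ℕ, M.γ ^ (t + 1) * M.expectedReward π s (t + 1) =
      ∑ u, M.γ * M.T s (π s) u * (M.γ ^ t * M.expectedReward π u t) := by
    intro t
    rw [expectedReward_succ, Finset.mul_sum]
    exact Finset.sum_congr rfl fun u _ => by ring
  rw [value, (M.summable_value π s).tsum_eq_zero_add, expectedReward_zero, pow_zero, one_mul,
    actionValue]
  simp_rw [term_succ]
  rw [Summable.tsum_finsetSum fun u _ => (M.summable_value π u).mul_left _, Finset.mul_sum]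
  simp_rw [tsum_mul_left, value, mul_assoc]

theorem gain_self (π : S → A) (s : S) : M.gain π s (π s) = 0 := by
  rw [gain, ← value_eq_actionValue, sub_self]

theorem value_sub_value (π π' : S → A) (s : S) :
    M.value π' s - M.value π s = M.gain π s (π' s) +
      M.γ * ∑ u, M.T s (π' s) u * (M.value π' u - M.value π u) := by
  rw [M.value_eq_actionValue π' s, actionValue, gain, actionValue]
  simp_rw [mul_sub, Finset.sum_sub_distrib]
  ring

theorem nonneg_of_discounted_le (π : S → A) {D : S → ℝ}
    (hD : ∀ s, M.γ * ∑ u, M.T s (π s) u * D u ≤ D s) (s : S) : 0 ≤ D s := by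
  have : Nonempty S := ⟨s⟩
  obtain ⟨m, hm⟩ := Finite.exists_min D
  have min_le_average : D m ≤ ∑ u, M.T m (π m) u * D u := by
    calc D m = ∑ u, M.T m (π m) u * D m := by rw [← Finset.sum_mul, M.T_sum, one_mul]
      _ ≤ _ := Finset.sum_le_sum fun u _ => mul_le_mul_of_nonneg_left (hm u) (M.T_nonneg _ _ _)
  have := mul_le_mul_of_nonneg_left min_le_average M.γ_nonneg
  have min_nonneg : 0 ≤ D m := by nlinarith [hD m, M.γ_lt_one]
  exact min_nonneg.trans (hm s)

theorem value_le_value_of_gain_nonneg {π π' : S → A} (h : ∀ s, 0 ≤ M.gain π s (π' s)) :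
    M.value π ≤ M.value π' := fun s =>
  sub_nonneg.1 <| M.nonneg_of_discounted_le π' (D := fun s => M.value π' s - M.value π s)
    (fun s => by linarith [M.value_sub_value π π' s, h s]) s

theorem value_le_value_of_gain_nonpos {π π' : S → A} (h : ∀ s, M.gain π s (π' s) ≤ 0) :
    M.value π' ≤ M.value π := fun s =>
  sub_nonneg.1 <| M.nonneg_of_discounted_le π' (D := fun s => M.value π s - M.value π' s)
    (fun s => by
      have := M.value_sub_value π π' s
      simp_rw [← neg_sub (M.value π _), mul_neg, Finset.sum_neg_distrib] at this
      linarith [h s]) s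

variable {M}

theorem isOptimal_of_improvableSet_eq_empty {π : S → A} (h : M.improvableSet π = ∅) :
    M.IsOptimal π := fun _ =>
  M.value_le_value_of_gain_nonpos fun s =>
    not_lt.1 fun hs => Set.eq_empty_iff_forall_notMem.1 h (s, _) hs

namespace IsLocallyImproving

variable {π π' : S → A} (h : M.IsLocallyImproving π π')

include h

theorem eq_or_gain_pos (s : S) : π' s = π s ∨ 0 < M.gain π s (π' s) := by
  obtain ⟨I, ⟨hI, -, -⟩, switched, kept⟩ := h
  by_cases hs : ∃ a, (s, a) ∈ I
  · obtain ⟨a, ha⟩ := hs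
    rw [switched s a ha]
    exact Or.inr (hI ha)
  · exact Or.inl (kept s (not_exists.1 hs))

theorem exists_gain_pos : ∃ s, 0 < M.gain π s (π' s) := by
  obtain ⟨I, ⟨hI, ⟨⟨s, a⟩, hsa⟩, -⟩, switched, -⟩ := h
  exact ⟨s, switched s a hsa ▸ hI hsa⟩

theorem value_lt : M.value π < M.value π' := by
  have value_le : M.value π ≤ M.value π' := by
    refine M.value_le_value_of_gain_nonneg fun s => ?_
    obtain hs | hs := h.eq_or_gain_pos s
    · rw [hs, gain_self]
    · exact hs.le
  obtain ⟨s, hs⟩ := h.exists_gain_pos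
  refine Pi.lt_def.2 ⟨value_le, s, sub_pos.1 ?_⟩
  rw [value_sub_value]
  exact add_pos_of_pos_of_nonneg hs (mul_nonneg M.γ_nonneg
    (Finset.sum_nonneg fun u _ => mul_nonneg (M.T_nonneg _ _ _) (sub_nonneg.2 (value_le u))))

end IsLocallyImproving

theorem IsHowardRun.isRun {π : ℕ → S → A} (h : M.IsHowardRun π) : M.IsRun π := fun t ht =>
  let ⟨I, hI, _, hswitch⟩ := h t ht
  ⟨I, hI, hswitch⟩

variable (M) in
/-- The MDP is deterministic and action `a` leads from state `s` to `next s a`. -/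
def IsSuccessorMap (next : S → A → S) : Prop :=
  ∀ s a, M.T s a (next s a) = 1

theorem IsDeterministic.exists_isSuccessorMap (h : M.IsDeterministic) :
    ∃ next, M.IsSuccessorMap next := by
  have exists_successor : ∀ s a, ∃ s', M.T s a s' = 1 := by
    intro s a
    by_contra! hne
    simpa [fun s' => (h s a s').resolve_right (hne s')] using M.T_sum s a
  choose next hnext using exists_successor
  exact ⟨next, hnext⟩

namespace IsSuccessorMap

variable {next : S → A → S} (hnext : M.IsSuccessorMap next)

include hnext

theorem T_eq_zero {s s' : S} {a : A} (h : s' ≠ next s a) : M.T s a s' = 0 := by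
  classical
  have sum_erase := M.T_sum s a
  rw [← Finset.add_sum_erase _ _ (Finset.mem_univ (next s a)), hnext, add_eq_left] at sum_erase
  exact (Finset.sum_eq_zero_iff_of_nonneg fun u _ => M.T_nonneg s a u).1 sum_erase s'
    (Finset.mem_erase.2 ⟨h, Finset.mem_univ _⟩)

theorem actionValue_eq (π : S → A) (s : S) (a : A) :
    M.actionValue π s a = M.R s a + M.γ * M.value π (next s a) := by
  rw [actionValue, Finset.sum_eq_single_of_mem (next s a) (Finset.mem_univ _)
    fun u _ hu => by rw [hnext.T_eq_zero hu, zero_mul], hnext, one_mul]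

theorem value_eq (π : S → A) (s : S) :
    M.value π s = M.R s (π s) + M.γ * M.value π (next s (π s)) := by
  rw [value_eq_actionValue, hnext.actionValue_eq]

theorem dependsOnlyOnOrbit_value (s : S) :
    DependsOnlyOnOrbit next s fun π => M.value π s := by
  intro π π' K hs closed agree
  obtain ⟨m, hm, hmax⟩ := Set.exists_max_image K (fun v => |M.value π v - M.value π' v|)
    K.toFinite ⟨s, hs⟩
  have contraction : |M.value π m - M.value π' m| =
      M.γ * |M.value π (next m (π m)) - M.value π' (next m (π m))| := by
    rw [hnext.value_eq π m, hnext.value_eq π' m, ← agree m hm, add_sub_add_left_eq_sub, ← mul_sub,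
      abs_mul, abs_of_nonneg M.γ_nonneg]
  have := mul_le_mul_of_nonneg_left (hmax _ (closed m hm)) M.γ_nonneg
  have max_nonpos : |M.value π m - M.value π' m| ≤ 0 := by
    nlinarith [M.γ_lt_one, abs_nonneg (M.value π m - M.value π' m)]
  exact sub_eq_zero.1 (abs_nonpos_iff.1 ((hmax s hs).trans max_nonpos))

theorem reward_lt_of_gain_pos {π : S → A} {s : S} {a : A} (h : 0 < M.gain π s a)
    (hs : next s (π s) = next s a) : M.R s (π s) < M.R s a := by
  rw [gain, hnext.actionValue_eq, hnext.value_eq π s, hs] at h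
  linarith

end IsSuccessorMap

end MDP

theorem card_image_le_sum_card_image {τ ι β : Type*} [LinearOrder τ] [Fintype ι] [Nonempty ι]
    [PartialOrder β] [DecidableEq β] {f : τ → ι → β} (T : Finset τ) (hf : MonotoneOn f T) :
    (T.image f).card ≤ ∑ i, (T.image (f · i)).card := by
  induction T using Finset.induction_on_max with
  | empty => simp
  | insert a T lt_a ih =>
    have image_mono : ∀ i, T.image (f · i) ⊆ (insert a T).image (f · i) := fun i =>
      Finset.image_subset_image (Finset.subset_insert a T)
    have le_sum := ih (hf.mono (Finset.coe_subset.2 (Finset.subset_insert a T)))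
    by_cases hnew : ∃ i, f a i ∉ T.image (f · i)
    · obtain ⟨i, hi⟩ := hnew
      rw [Finset.image_insert]
      refine (Finset.card_insert_le _ _).trans ((Nat.succ_le_succ le_sum).trans ?_)
      refine Nat.succ_le_of_lt (Finset.sum_lt_sum (fun j _ => Finset.card_le_card (image_mono j))
        ⟨i, Finset.mem_univ i, Finset.card_lt_card (Finset.ssubset_iff.2 ⟨f a i, hi, ?_⟩)⟩)
      rw [Finset.image_insert]
    · simp only [not_exists, not_not] at hnew
      obtain ⟨b, hb, hb_max⟩ : ∃ b ∈ T, ∀ x ∈ T, x ≤ b := by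
        obtain ⟨x, hx, -⟩ := Finset.mem_image.1 (hnew (Classical.arbitrary ι))
        exact ⟨T.max' ⟨x, hx⟩, T.max'_mem _, T.le_max'⟩
      have eq_last : f b = f a := by
        refine (hf (by simp [hb]) (by simp) (lt_a b hb).le).antisymm fun i => ?_
        obtain ⟨x, hx, hxi⟩ := Finset.mem_image.1 (hnew i)
        exact hxi ▸ hf (by simp [hx]) (by simp [hb]) (hb_max x hx) i
      rw [Finset.image_insert, Finset.insert_eq_of_mem (eq_last ▸ Finset.mem_image_of_mem f hb)]
      exact le_sum.trans (Finset.sum_le_sum fun i _ => Finset.card_le_card (image_mono i))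

namespace MDP

variable {S A : Type*} [Fintype S] {M : MDP S A} {next : S → A → S}

/-- All actions at `s` lead to the same state. -/
def HasSoleSuccessor (next : S → A → S) (s : S) : Prop :=
  ∀ a a', next s a = next s a'

open Classical in
variable (M next) in
/-- The rewards which `π` collects at the states with a sole successor, and `0` at all other states.
Along a run these rewards increase, so they divide the run into few phases. -/
noncomputable def soleRewards (π : S → A) (s : S) : ℝ :=
  if HasSoleSuccessor next s then M.R s (π s) else 0

theorem soleRewards_of_hasSoleSuccessor {s : S} (hs : HasSoleSuccessor next s) (π : S → A) :
    M.soleRewards next π s = M.R s (π s) :=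
  if_pos hs

theorem soleRewards_of_not_hasSoleSuccessor {s : S} (hs : ¬HasSoleSuccessor next s) (π : S → A) :
    M.soleRewards next π s = 0 :=
  if_neg hs

open Classical in
theorem card_image_soleRewards_le [Fintype A] [Nonempty A] (P : Finset (S → A)) (s : S) :
    (P.image (M.soleRewards next · s)).card ≤ Fintype.card A := by
  by_cases hs : HasSoleSuccessor next s
  · have image_subset : P.image (M.soleRewards next · s) ⊆ Finset.univ.image (M.R s) := by
      simp only [soleRewards_of_hasSoleSuccessor hs]
      grind
    exact (Finset.card_le_card image_subset).trans Finset.card_image_le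
  · simp only [soleRewards_of_not_hasSoleSuccessor hs]
    exact (Finset.card_le_card (Finset.image_subset_iff.2 fun _ _ =>
      Finset.mem_singleton_self 0)).trans Fintype.card_pos

open Classical in
theorem IsSuccessorMap.card_image_value_le [Fintype A] [Nontrivial S] {α : ℝ}
    (hnext : M.IsSuccessorMap next) (h : IsMetallicMean α ((Fintype.card A : ℝ) - 1))
    {P : Finset (S → A)}
    (agree : ∀ π ∈ P, ∀ π' ∈ P, ∀ s, HasSoleSuccessor next s → π s = π' s) (s : S) :
    ((P.image (M.value · s)).card : ℝ) ≤
      Fintype.card A * (Fintype.card S * (2 * α ^ (Fintype.card S - 1))) := by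
  obtain rfl | ⟨π₀, hπ₀⟩ := P.eq_empty_or_nonempty
  · have := h.pos
    simp only [Finset.image_empty, Finset.card_empty, Nat.cast_zero]
    positivity
  set Act : S → Finset A := fun v =>
    if HasSoleSuccessor next v then {π₀ v} else Finset.univ with hAct
  refine card_image_le_of_dependsOnlyOnOrbit (Act := Act) h (fun v => Finset.card_le_univ _)
    (fun v y => ?_) (hnext.dependsOnlyOnOrbit_value s) P fun π hπ v => ?_
  · by_cases hv : HasSoleSuccessor next v
    · rw [hAct]
      simp only [if_pos hv]
      exact (Finset.card_filter_le _ _).trans_lt (by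
        rw [Finset.card_singleton]
        exact h.two_le_natCast)
    · rw [hAct]
      simp only [if_neg hv]
      refine Finset.card_lt_card (Finset.filter_ssubset.2 ?_)
      by_contra! hy
      exact hv fun a a' => (hy a (Finset.mem_univ a)).trans (hy a' (Finset.mem_univ a')).symm
  · by_cases hv : HasSoleSuccessor next v
    · simpa only [hAct, if_pos hv, Finset.mem_singleton] using agree π hπ π₀ hπ₀ v hv
    · simp only [hAct, if_neg hv, Finset.mem_univ]

section Run

variable {π : ℕ → S → A} {m : ℕ}

theorem strictMonoOn_value (hπ : ∀ t < m, M.IsLocallyImproving (π t) (π (t + 1))) :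
    StrictMonoOn (fun t => M.value (π t)) (Set.Iic m) :=
  strictMonoOn_of_lt_succ Set.ordConnected_Iic fun t _ _ ht => (hπ t ht).value_lt

theorem IsSuccessorMap.eq_or_reward_lt (hnext : M.IsSuccessorMap next)
    (hπ : ∀ t < m, M.IsLocallyImproving (π t) (π (t + 1))) {s : S}
    (hs : HasSoleSuccessor next s) {t t' : ℕ} (h : t ≤ t') (hm : t' ≤ m) :
    π t s = π t' s ∨ M.R s (π t s) < M.R s (π t' s) := by
  induction t', h using Nat.le_induction with
  | base => exact Or.inl rfl
  | succ t' _ ih =>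
    have step := ((hπ t' hm).eq_or_gain_pos s).imp_right fun h =>
      hnext.reward_lt_of_gain_pos h (hs _ _)
    obtain eq | lt := ih (t'.le_succ.trans hm)
    · rw [eq]
      exact step.imp_left Eq.symm
    · obtain eq | lt_step := step
      · rw [eq]
        exact Or.inr lt
      · exact Or.inr (lt.trans lt_step)

theorem IsSuccessorMap.monotoneOn_soleRewards (hnext : M.IsSuccessorMap next)
    (hπ : ∀ t < m, M.IsLocallyImproving (π t) (π (t + 1))) :
    MonotoneOn (fun t => M.soleRewards next (π t)) (Set.Iic m) := by
  intro t _ t' ht' h s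
  by_cases hs : HasSoleSuccessor next s
  · simp only [soleRewards_of_hasSoleSuccessor hs]
    obtain e | lt := hnext.eq_or_reward_lt hπ hs h ht'
    · rw [e]
    · exact lt.le
  · simp only [soleRewards_of_not_hasSoleSuccessor hs, le_refl]

theorem IsSuccessorMap.eq_of_soleRewards_eq (hnext : M.IsSuccessorMap next)
    (hπ : ∀ t < m, M.IsLocallyImproving (π t) (π (t + 1))) {t t' : ℕ} (ht : t ≤ m) (ht' : t' ≤ m)
    (h : M.soleRewards next (π t) = M.soleRewards next (π t')) {s : S}
    (hs : HasSoleSuccessor next s) : π t s = π t' s := by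
  have reward_eq := congrFun h s
  simp only [soleRewards_of_hasSoleSuccessor hs] at reward_eq
  obtain htt' | htt' := le_total t t'
  · exact (hnext.eq_or_reward_lt hπ hs htt' ht').resolve_right reward_eq.not_lt
  · exact ((hnext.eq_or_reward_lt hπ hs htt' ht).resolve_right reward_eq.not_gt).symm

theorem IsSuccessorMap.card_phase_le [Fintype A] [Nontrivial S] {α : ℝ}
    (hnext : M.IsSuccessorMap next) (h : IsMetallicMean α ((Fintype.card A : ℝ) - 1))
    (hπ : ∀ t < m, M.IsLocallyImproving (π t) (π (t + 1))) {U : Finset ℕ}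
    (hU : (U : Set ℕ) ⊆ Set.Iic m)
    (agree : ∀ t ∈ U, ∀ t' ∈ U, ∀ s, HasSoleSuccessor next s → π t s = π t' s) :
    (U.card : ℝ) ≤ Fintype.card S *
      (Fintype.card A * (Fintype.card S * (2 * α ^ (Fintype.card S - 1)))) := by
  classical
  have strictMono := (strictMonoOn_value hπ).mono hU
  have card_le : U.card ≤ ∑ s, (U.image fun t => M.value (π t) s).card := by
    rw [← Finset.card_image_of_injOn strictMono.injOn]
    exact card_image_le_sum_card_image U strictMono.monotoneOn
  have coordinate_le : ∀ s ∈ Finset.univ, ((U.image fun t => M.value (π t) s).card : ℝ) ≤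
      Fintype.card A * (Fintype.card S * (2 * α ^ (Fintype.card S - 1))) := by
    intro s _
    have := hnext.card_image_value_le h (P := U.image π) (by simpa using agree) s
    rwa [Finset.image_image] at this
  calc (U.card : ℝ) ≤ ∑ s, ((U.image fun t => M.value (π t) s).card : ℝ) := by
        exact_mod_cast card_le
    _ ≤ _ := by
      rw [← nsmul_eq_mul]
      exact Finset.sum_le_card_nsmul _ _ _ coordinate_le

theorem IsSuccessorMap.run_length_le [Fintype A] [Nontrivial S] {α : ℝ}
    (hnext : M.IsSuccessorMap next) (h : IsMetallicMean α ((Fintype.card A : ℝ) - 1))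
    (hπ : ∀ t < m, M.IsLocallyImproving (π t) (π (t + 1))) :
    (m : ℝ) + 1 ≤ 2 * Fintype.card S ^ 3 * Fintype.card A ^ 2 * α ^ (Fintype.card S - 1) := by
  classical
  have : Nonempty A := Fintype.card_pos_iff.1 (two_pos.trans_le h.two_le_natCast)
  set rewards : ℕ → S → ℝ := fun t => M.soleRewards next (π t)
  have phases_le : ((Finset.Iic m).image rewards).card ≤ Fintype.card S * Fintype.card A := by
    refine (card_image_le_sum_card_image (Finset.Iic m)
      (by simpa using hnext.monotoneOn_soleRewards hπ)).trans ?_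
    refine (Finset.sum_le_card_nsmul _ _ (Fintype.card A) fun s _ => ?_).trans_eq (smul_eq_mul _ _)
    have := card_image_soleRewards_le (M := M) (next := next) ((Finset.Iic m).image π) s
    rwa [Finset.image_image] at this
  have phase_le : ∀ x ∈ (Finset.Iic m).image rewards,
      (({t ∈ Finset.Iic m | rewards t = x} : Finset ℕ).card : ℝ) ≤ Fintype.card S *
        (Fintype.card A * (Fintype.card S * (2 * α ^ (Fintype.card S - 1)))) := by
    intro x _
    refine hnext.card_phase_le h hπ (fun t ht => Finset.mem_Iic.1 (Finset.mem_filter.1 ht).1)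
      fun t ht t' ht' s hs => ?_
    rw [Finset.mem_filter, Finset.mem_Iic] at ht ht'
    exact hnext.eq_of_soleRewards_eq hπ ht.1 ht'.1 (ht.2.trans ht'.2.symm) hs
  have hα := h.pos
  calc (m : ℝ) + 1 = ((Finset.Iic m).card : ℝ) := by simp
    _ = ∑ x ∈ (Finset.Iic m).image rewards,
        (({t ∈ Finset.Iic m | rewards t = x} : Finset ℕ).card : ℝ) := by
      exact_mod_cast Finset.card_eq_sum_card_image rewards _
    _ ≤ ((Finset.Iic m).image rewards).card * (Fintype.card S *
        (Fintype.card A * (Fintype.card S * (2 * α ^ (Fintype.card S - 1))))) := by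
      rw [← nsmul_eq_mul]
      exact Finset.sum_le_card_nsmul _ _ _ phase_le
    _ ≤ (Fintype.card S * Fintype.card A : ℕ) * (Fintype.card S *
        (Fintype.card A * (Fintype.card S * (2 * α ^ (Fintype.card S - 1))))) := by
      gcongr
    _ = _ := by
      push_cast
      ring

end Run

end MDP

theorem growthRate_sq (k : ℕ) : growthRate k ^ 2 = ((k : ℝ) - 1) * growthRate k + 1 := by
  have sqrt_sq : Real.sqrt (((k : ℝ) - 1) ^ 2 + 4) ^ 2 = ((k : ℝ) - 1) ^ 2 + 4 :=
    Real.sq_sqrt (by positivity)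
  rw [growthRate]
  linear_combination sqrt_sq / 4

theorem sub_one_lt_growthRate (k : ℕ) : (k : ℝ) - 1 < growthRate k := by
  have : (k : ℝ) - 1 < Real.sqrt (((k : ℝ) - 1) ^ 2 + 4) :=
    Real.lt_sqrt_of_sq_lt (by linarith)
  rw [growthRate]
  linarith

theorem isMetallicMean_growthRate {k : ℕ} (hk : 2 ≤ k) :
    IsMetallicMean (growthRate k) ((k : ℝ) - 1) := by
  have one_le : (1 : ℝ) ≤ k - 1 := by
    have : (2 : ℝ) ≤ k := by exact_mod_cast hk
    linarith
  exact ⟨by linarith [sub_one_lt_growthRate k], one_le, growthRate_sq k⟩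

theorem growthRate_two : growthRate 2 = Real.goldenRatio := by
  rw [growthRate, Real.goldenRatio]
  norm_num

theorem growthRate_bound_le {n k : ℕ} (hn : 1 ≤ n) (hk : 2 ≤ k) :
    5 * (n : ℝ) ^ 3 * (k : ℝ) ^ 2 * growthRate k ^ (n - 1) ≤
      10 * ((n : ℝ) ^ 3 * (k : ℝ) * growthRate k ^ n) := by
  have h := isMetallicMean_growthRate hk
  have hα := h.pos
  have k_le : (k : ℝ) ≤ 2 * growthRate k := by linarith [h.one_le, h.lt]
  calc 5 * (n : ℝ) ^ 3 * (k : ℝ) ^ 2 * growthRate k ^ (n - 1)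
      = 5 * (n : ℝ) ^ 3 * k * growthRate k ^ (n - 1) * k := by ring
    _ ≤ 5 * (n : ℝ) ^ 3 * k * growthRate k ^ (n - 1) * (2 * growthRate k) := by gcongr
    _ = 10 * ((n : ℝ) ^ 3 * k * growthRate k ^ n) := by
      rw [← pow_sub_one_mul (Nat.one_le_iff_ne_zero.1 hn) (growthRate k)]
      ring

theorem goldenRatio_pow_le_three_mul_fib {n : ℕ} (hn : n ≠ 0) :
    Real.goldenRatio ^ n ≤ 3 * (Nat.fib n : ℝ) := by
  obtain ⟨m, rfl⟩ := Nat.exists_eq_succ_of_ne_zero hn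
  have fib_succ_le : (Nat.fib (m + 2) : ℝ) ≤ 2 * Nat.fib (m + 1) := by
    rw [Nat.fib_add_two, Nat.cast_add]
    linarith [(Nat.cast_le (α := ℝ)).2 (Nat.fib_le_fib_succ (n := m))]
  rw [← Real.fib_succ_sub_goldenConj_mul_fib]
  nlinarith [Real.neg_one_lt_goldenConj, (Nat.fib (m + 1)).cast_nonneg (α := ℝ)]

namespace MDP

variable {S A : Type*} [Fintype S] [Fintype A] [Nontrivial S] {M : MDP S A} {π : ℕ → S → A}

theorem IsDeterministic.run_length_le (hM : M.IsDeterministic) (hA : 2 ≤ Fintype.card A) {m : ℕ}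
    (hπ : ∀ t < m, M.IsLocallyImproving (π t) (π (t + 1))) :
    (m : ℝ) + 1 ≤ 5 * (Fintype.card S : ℝ) ^ 3 * (Fintype.card A : ℝ) ^ 2 *
      growthRate (Fintype.card A) ^ (Fintype.card S - 1) := by
  have h := isMetallicMean_growthRate hA
  have := h.pos
  obtain ⟨next, hnext⟩ := hM.exists_isSuccessorMap
  refine (hnext.run_length_le h hπ).trans ?_
  gcongr
  norm_num

theorem IsRun.exists_terminatesAt (hπ : M.IsRun π) (hM : M.IsDeterministic)
    (hA : 2 ≤ Fintype.card A) :
    ∃ ℓ : ℕ, M.TerminatesAt π ℓ ∧ M.IsOptimal (π ℓ) ∧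
      (ℓ : ℝ) + 1 ≤ 5 * (Fintype.card S : ℝ) ^ 3 * (Fintype.card A : ℝ) ^ 2 *
        growthRate (Fintype.card A) ^ (Fintype.card S - 1) := by
  classical
  have terminates : ∃ t, M.improvableSet (π t) = ∅ := by
    by_contra! nonempty
    obtain ⟨m, hm⟩ := exists_nat_gt (5 * (Fintype.card S : ℝ) ^ 3 * (Fintype.card A : ℝ) ^ 2 *
      growthRate (Fintype.card A) ^ (Fintype.card S - 1))
    linarith [hM.run_length_le hA (m := m) fun t _ => hπ t (nonempty t)]
  have nonempty_before : ∀ t < Nat.find terminates, (M.improvableSet (π t)).Nonempty :=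
    fun t ht => Set.nonempty_iff_ne_empty.2 (Nat.find_min terminates ht)
  exact ⟨Nat.find terminates, ⟨nonempty_before, Nat.find_spec terminates⟩,
    isOptimal_of_improvableSet_eq_empty (Nat.find_spec terminates),
    hM.run_length_le hA fun t ht => hπ t (nonempty_before t ht)⟩

theorem IsRun.exists_terminatesAt_of_card_eq_two (hπ : M.IsRun π) (hM : M.IsDeterministic)
    (hA : Fintype.card A = 2) :
    ∃ ℓ : ℕ, M.TerminatesAt π ℓ ∧ M.IsOptimal (π ℓ) ∧
      (ℓ : ℝ) + 1 ≤ 20 * (Fintype.card S : ℝ) ^ 3 * Real.goldenRatio ^ Fintype.card S := by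
  obtain ⟨ℓ, terminates, optimal, bound⟩ := hπ.exists_terminatesAt hM hA.ge
  refine ⟨ℓ, terminates, optimal, bound.trans ?_⟩
  rw [hA, ← growthRate_two]
  refine (growthRate_bound_le Fintype.card_pos le_rfl).trans_eq ?_
  push_cast
  ring

theorem IsHowardRun.exists_terminatesAt_of_card_eq_two (hπ : M.IsHowardRun π)
    (hM : M.IsDeterministic) (hA : Fintype.card A = 2) :
    ∃ ℓ : ℕ, M.TerminatesAt π ℓ ∧ M.IsOptimal (π ℓ) ∧
      (ℓ : ℝ) + 1 ≤ 60 * (Fintype.card S : ℝ) ^ 3 * (Nat.fib (Fintype.card S) : ℝ) := by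
  obtain ⟨ℓ, terminates, optimal, bound⟩ := hπ.isRun.exists_terminatesAt_of_card_eq_two hM hA
  refine ⟨ℓ, terminates, optimal, bound.trans ?_⟩
  calc 20 * (Fintype.card S : ℝ) ^ 3 * Real.goldenRatio ^ Fintype.card S
      ≤ 20 * (Fintype.card S : ℝ) ^ 3 * (3 * Nat.fib (Fintype.card S)) := by
        gcongr
        exact goldenRatio_pow_le_three_mul_fib Fintype.card_ne_zero
    _ = 60 * (Fintype.card S : ℝ) ^ 3 * Nat.fib (Fintype.card S) := by ring

end MDP

theorem mainTheorem1 :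
    -- every run on an `n`-state, `k`-action DMDP stops, at an optimal policy, and visits at most
    -- `5 n³ k² α(k)ⁿ⁻¹` policies
    (∀ (S : Type u) (A : Type v) [Fintype S] [Fintype A] (M : MDP S A) (π : ℕ → S → A),
      2 ≤ Fintype.card S → 2 ≤ Fintype.card A → M.IsDeterministic → M.IsRun π →
      ∃ ℓ : ℕ, M.TerminatesAt π ℓ ∧ M.IsOptimal (π ℓ) ∧
        (ℓ : ℝ) + 1 ≤ 5 * (Fintype.card S : ℝ) ^ 3 * (Fintype.card A : ℝ) ^ 2 *
          growthRate (Fintype.card A) ^ (Fintype.card S - 1)) ∧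
    -- the bound is `O(n³ k α(k)ⁿ)`, uniformly in `n` and `k`
    (∃ C : ℝ, 0 < C ∧ ∀ n k : ℕ, 2 ≤ n → 2 ≤ k →
      5 * (n : ℝ) ^ 3 * (k : ℝ) ^ 2 * growthRate k ^ (n - 1) ≤
        C * ((n : ℝ) ^ 3 * (k : ℝ) * growthRate k ^ n)) ∧
    -- two actions: `O(n³ φⁿ)` for every run
    (∃ C : ℝ, 0 < C ∧
      ∀ (S : Type u) (A : Type v) [Fintype S] [Fintype A] (M : MDP S A) (π : ℕ → S → A),
        2 ≤ Fintype.card S → Fintype.card A = 2 → M.IsDeterministic → M.IsRun π →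
        ∃ ℓ : ℕ, M.TerminatesAt π ℓ ∧ M.IsOptimal (π ℓ) ∧
          (ℓ : ℝ) + 1 ≤ C * (Fintype.card S : ℝ) ^ 3 * Real.goldenRatio ^ Fintype.card S) ∧
    -- two actions, Howard's policy iteration: Fibonacci growth up to a polynomial factor
    (∃ C : ℝ, 0 < C ∧
      ∀ (S : Type u) (A : Type v) [Fintype S] [Fintype A] (M : MDP S A) (π : ℕ → S → A),
        2 ≤ Fintype.card S → Fintype.card A = 2 → M.IsDeterministic → M.IsHowardRun π →
        ∃ ℓ : ℕ, M.TerminatesAt π ℓ ∧ M.IsOptimal (π ℓ) ∧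
          (ℓ : ℝ) + 1 ≤ C * (Fintype.card S : ℝ) ^ 3 * (Nat.fib (Fintype.card S) : ℝ)) := by
  have nontrivial (S : Type u) [Fintype S] (hS : 2 ≤ Fintype.card S) : Nontrivial S :=
    Fintype.one_lt_card_iff_nontrivial.1 hS
  refine ⟨?_, ⟨10, by norm_num, ?_⟩, ⟨20, by norm_num, ?_⟩, ⟨60, by norm_num, ?_⟩⟩
  · intro S A _ _ M π hS hA hM hπ
    have := nontrivial S hS
    exact hπ.exists_terminatesAt hM hA
  · intro n k hn hk
    exact growthRate_bound_le (one_le_two.trans hn) hk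
  · intro S A _ _ M π hS hA hM hπ
    have := nontrivial S hS
    exact hπ.exists_terminatesAt_of_card_eq_two hM hA
  · intro S A _ _ M π hS hA hM hπ
    have := nontrivial S hS
    exact hπ.exists_terminatesAt_of_card_eq_two hM hA
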